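/- Let $(\Sigma,\omega)$ be a smooth connected symplectic surface without boundary (a connected smooth 2-manifold, not necessarily compact, with an area form $\omega$), and let $\{F,G\}$ be the Poisson bracket, determined by $\{F,G\}\,\omega=-dF\wedge dG$. For $1\le q\le\infty$ let $\|\cdot\|_q$ be the $L_q$-norm with respect to the area measure of $\omega$ (for $q=\infty$, the uniform norm). For subsets $X_0,X_1,Y_0,Y_1\subset\Sigma$ put $$pb_4^q(X_0,X_1,Y_0,Y_1)=\inf_{(F,G)}\|\{F,G\}\|_q ,$$ the infimum being over all pairs of compactly supported smooth functions $F,G:\Sigma\to\mathbb R$ with $F\le 0$ on $X_0$, $F\ge 1$ on $X_1$, $G\le 0$ on $Y_0$, $G\ge 1$ on $Y_1$. Let $\tau\subset\Sigma$ be a smooth simple closed curve, i.e. the image $\tau=\alpha(S^1)$ of a smooth embedding $\alpha:S^1\hookrightarrow\Sigma$. Four distinct points of $S^1$ divide $S^1$ into four closed segments; let $\Delta_1,\Delta_2,\Delta_3,\Delta_4\subset\tau$ be their images under $\alpha$, listed in cyclic order, and put $pb_4^q(\tau)=pb_4^q(\Delta_1,\Delta_3,\Delta_2,\Delta_4)$,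 so that $F$ separates the opposite segments $\Delta_1,\Delta_3$ and $G$ separates the opposite segments $\Delta_2,\Delta_4$. Theorem. If $\tau$ is non-separating, i.e. $\Sigma\setminus\tau$ is connected, then $pb_4^q(\tau)=0$ for every $1\le q\le\infty$ and for every choice of the division of $\tau$ into four segments. -/

import Mathlib

open Set MeasureTheory Manifold
open scoped ContDiff ENNReal

noncomputable section

/-- The model plane `ℝ²` of the surfaces considered here (Euclidean norm, Lebesgue measure). -/
abbrev Plane : Type := EuclideanSpace ℝ (Fin 2)

/-- The basis `∂₀, ∂₁` of the tangent space at `x` given by the preferred chart at `x` (for `M` the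
model plane, the standard basis). -/
def tangentBasis {M : Type*} [TopologicalSpace M] [ChartedSpace Plane M] (x : M) (i : Fin 2) :
    TangentSpace (𝓡 2) x :=
  (EuclideanSpace.single i 1 : Plane)

/-- Expansion of a tangent vector in this basis. -/
theorem exists_tangentBasis_expansion {M : Type*} [TopologicalSpace M] [ChartedSpace Plane M]
    {x : M} (v : TangentSpace (𝓡 2) x) :
    ∃ a b : ℝ, v = a • tangentBasis x 0 + b • tangentBasis x 1 := by
  have h : ∀ v : Plane, v = v 0 • EuclideanSpace.single (0 : Fin 2) (1 : ℝ) +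
      v 1 • EuclideanSpace.single (1 : Fin 2) (1 : ℝ) := by
    intro v
    ext i
    fin_cases i <;> simp
  exact ⟨_, _, h v⟩

theorem tangentBasis_ne_zero {M : Type*} [TopologicalSpace M] [ChartedSpace Plane M] (x : M)
    (i : Fin 2) : tangentBasis x i ≠ 0 := by
  intro h
  have h' : (EuclideanSpace.single i 1 : Plane) = 0 := h
  simp at h'

/-- A symplectic form on a smooth surface `M`, that is, an area form: a smooth alternating 2-form
which is non-degenerate at every point.  (In dimension two every 2-form is closed, since its exterior
derivative is a 3-form on a two-dimensional space; so no closedness field is needed.) -/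
structure SymplecticForm (M : Type*) [TopologicalSpace M] [ChartedSpace Plane M]
    [IsManifold (𝓡 2) ∞ M] where
  /-- The value of the form at a point, as a bilinear form on the tangent space. -/
  form (x : M) : TangentSpace (𝓡 2) x →L[ℝ] TangentSpace (𝓡 2) x →L[ℝ] ℝ
  alternating (x : M) (v : TangentSpace (𝓡 2) x) : form x v v = 0
  nondegenerate (x : M) (v : TangentSpace (𝓡 2) x) (h : ∀ w, form x v w = 0) : v = 0
  smooth : ContMDiff (𝓡 2) ((𝓡 2).prod 𝓘(ℝ, Plane →L[ℝ] Plane →L[ℝ] ℝ)) ∞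
    (fun x ↦ (⟨x, form x⟩ : Bundle.TotalSpace (Plane →L[ℝ] Plane →L[ℝ] ℝ)
      (fun x : M ↦ TangentSpace (𝓡 2) x →L[ℝ] TangentSpace (𝓡 2) x →L[ℝ] ℝ)))

section Surface

variable {M : Type*} [TopologicalSpace M] [ChartedSpace Plane M] [IsManifold (𝓡 2) ∞ M]

/-- The value `(dF ∧ dG)(v, w)` at the point `x`. -/
def wedgeDifferentials (F G : M → ℝ) (x : M) (v w : TangentSpace (𝓡 2) x) : ℝ :=
  mvfderiv (𝓡 2) F x v * mvfderiv (𝓡 2) G x w - mvfderiv (𝓡 2) F x w * mvfderiv (𝓡 2) G x v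

/-- The Poisson bracket `{F, G}`, the function with `{F, G} Ω = - dF ∧ dG`: both sides are evaluated
on a basis of the tangent space.  See `poissonBracket_mul_form` for the identity on all vectors. -/
def poissonBracket (Ω : SymplecticForm M) (F G : M → ℝ) (x : M) : ℝ :=
  -wedgeDifferentials F G x (tangentBasis x 0) (tangentBasis x 1) /
    Ω.form x (tangentBasis x 0) (tangentBasis x 1)

/-- The density `|Ω(∂₀, ∂₁)|` of the form at the point with coordinates `y` in the preferred
chart at `p`. -/
def areaDensity (Ω : SymplecticForm M) (p : M) (y : Plane) : ℝ≥0∞ :=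
  let φ := extChartAt (𝓡 2) p
  let e (i : Fin 2) : TangentSpace (𝓡 2) (φ.symm y) :=
    mfderiv 𝓘(ℝ, Plane) (𝓡 2) φ.symm y (tangentBasis y i)
  ‖Ω.form (φ.symm y) (e 0) (e 1)‖ₑ

/-- The area measure `|Ω|` on the domain of the preferred chart at `p`, extended by zero:
in coordinates it is `|Ω(∂₀, ∂₁)|` times Lebesgue measure. -/
def chartAreaMeasure [MeasurableSpace M] (Ω : SymplecticForm M) (p : M) : Measure M :=
  ((volume.restrict (extChartAt (𝓡 2) p).target).withDensity (areaDensity Ω p)).map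
    (extChartAt (𝓡 2) p).symm

/-- The area measure of `Ω` on `M`: the least measure which is at least `chartAreaMeasure Ω p` for
each `p`.  As these measures agree on overlaps of chart domains, it is the measure that restricts to
`chartAreaMeasure Ω p` on the domain of the preferred chart at `p`, for every `p`. -/
def areaMeasure [MeasurableSpace M] (Ω : SymplecticForm M) : Measure M :=
  ⨆ p : M, chartAreaMeasure Ω p

/-- The `L_q`-norm of a function on `M` for `1 ≤ q ≤ ∞`: `(∫ |f|^q Ω)^(1/q)` if `q` is finite,
and the uniform norm if `q = ∞`. -/
def lqNorm [MeasurableSpace M] (Ω : SymplecticForm M) (q : ℝ≥0∞) (f : M → ℝ) : ℝ≥0∞ :=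
  if q = ⊤ then ⨆ x, ‖f x‖ₑ else (∫⁻ x, ‖f x‖ₑ ^ q.toReal ∂(areaMeasure Ω)) ^ (1 / q.toReal)

/-- Membership in `C_c^∞(M)`. -/
def IsSmoothCompactlySupported (F : M → ℝ) : Prop :=
  ContMDiff (𝓡 2) 𝓘(ℝ, ℝ) ∞ F ∧ HasCompactSupport F

/-- The pairs of functions `F, G ∈ C_c^∞(M)` with `F ≤ 0` on `X₀`, `F ≥ 1` on `X₁`, `G ≤ 0` on `Y₀`
and `G ≥ 1` on `Y₁`. -/
def admissiblePairs (X₀ X₁ Y₀ Y₁ : Set M) : Set ((M → ℝ) × (M → ℝ)) :=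
  {P | IsSmoothCompactlySupported P.1 ∧ IsSmoothCompactlySupported P.2 ∧
    (∀ x ∈ X₀, P.1 x ≤ 0) ∧ (∀ x ∈ X₁, 1 ≤ P.1 x) ∧
    (∀ x ∈ Y₀, P.2 x ≤ 0) ∧ (∀ x ∈ Y₁, 1 ≤ P.2 x)}

/-- The Poisson bracket invariant `pb₄^q(X₀, X₁, Y₀, Y₁)`. -/
def pb4 [MeasurableSpace M] (Ω : SymplecticForm M) (q : ℝ≥0∞) (X₀ X₁ Y₀ Y₁ : Set M) : ℝ≥0∞ :=
  ⨅ P ∈ admissiblePairs X₀ X₁ Y₀ Y₁, lqNorm Ω q (poissonBracket Ω P.1 P.2)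

/-- The closed segment of the circle from angle `a` to angle `b`. -/
def circleSegment (a b : ℝ) : Set Circle := Circle.exp '' Icc a b

/-- The invariant `pb₄^q(τ)` of the curve `τ = α(S¹)`, computed from the division of `S¹` by the
points `exp(i t₀), …, exp(i t₃)`, where `t₀ < t₁ < t₂ < t₃ < t₀ + 2π`, into four segments, with images
`Δ₁, Δ₂, Δ₃, Δ₄` listed in cyclic order.  The function `F` separates the opposite segments `Δ₁, Δ₃`,
and `G` separates the opposite segments `Δ₂, Δ₄`. -/
def curvePb4 [MeasurableSpace M] (Ω : SymplecticForm M) (q : ℝ≥0∞) (α : Circle → M)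
    (t : Fin 4 → ℝ) : ℝ≥0∞ :=
  let Δ₁ := α '' circleSegment (t 0) (t 1)
  let Δ₂ := α '' circleSegment (t 1) (t 2)
  let Δ₃ := α '' circleSegment (t 2) (t 3)
  let Δ₄ := α '' circleSegment (t 3) (t 0 + 2 * Real.pi)
  pb4 Ω q Δ₁ Δ₃ Δ₂ Δ₄

/-- A symplectic form does not vanish on the basis `∂₀, ∂₁`. -/
theorem SymplecticForm.form_basis_ne_zero (Ω : SymplecticForm M) (x : M) :
    Ω.form x (tangentBasis x 0) (tangentBasis x 1) ≠ 0 := by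
  intro h
  refine tangentBasis_ne_zero x 0 (Ω.nondegenerate x _ fun w ↦ ?_)
  obtain ⟨a, b, rfl⟩ := exists_tangentBasis_expansion w
  rw [map_add, map_smul, map_smul, Ω.alternating, h]
  simp

/-- The identity `{F, G} Ω = - dF ∧ dG`, on all pairs of tangent vectors. -/
theorem poissonBracket_mul_form (Ω : SymplecticForm M) (F G : M → ℝ) (x : M)
    (v w : TangentSpace (𝓡 2) x) :
    poissonBracket Ω F G x * Ω.form x v w = -wedgeDifferentials F G x v w := by
  have hne := Ω.form_basis_ne_zero x
  have hskew : Ω.form x (tangentBasis x 1) (tangentBasis x 0) =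
      -Ω.form x (tangentBasis x 0) (tangentBasis x 1) := by
    have h := Ω.alternating x (tangentBasis x 0 + tangentBasis x 1)
    simp only [map_add, add_apply, Ω.alternating] at h
    linarith
  obtain ⟨a, b, rfl⟩ := exists_tangentBasis_expansion v
  obtain ⟨c, d, rfl⟩ := exists_tangentBasis_expansion w
  simp only [poissonBracket, wedgeDifferentials, map_add, map_smul, add_apply,
    smul_apply, smul_eq_mul, Ω.alternating, hskew]
  field_simp
  ring

end Surface

end

/-!
The invariant vanishes because there is an admissible pair `F, G` with `{F, G} = 0` everywhere: it
suffices that the map `(F, G) : M → ℝ²` has rank at most one. Such pairs are obtained by composing a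
smooth map `P : M → ℂ \ {0}` with two functions of the direction `P / |P|`
(`poissonBracket_comp_eq_zero`). If the four segments of the curve go, approximately, to the four
quadrants of the unit circle, and if the direction of `P` is close to `1` outside a compact set,
then suitable smooth steps `dirStep` of the direction are compactly supported and satisfy the
required inequalities on the segments. By smooth approximation it is therefore enough to find a
continuous `H : M → Circle` that is `1` outside a compact set and that restricts to a prescribed map
`k` of degree one on the curve (`exists_map_to_quadrants`, `exists_continuous_extension`).

The heart of the matter is a continuous `H`, equal to `1` outside a compact set, of degree `±1` on
the curve. It is dual to a closed curve which crosses the given one exactly once, but no such closed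
curve, let alone a tubular neighbourhood of it, has to be constructed: circle-valued maps can be
multiplied, so that it suffices to produce `H` with singularities of opposite indices and to cancel
these. In a positively oriented complex chart, the direction of `(z - a) / (z - b)`, flattened to
`1` far away from the poles, has index `1` at `a` and `-1` at `b` (`exists_hasIndex_pairIndex`). Take
`a` and `b` on the two sides of the curve, close to one of its points; this map has degree `±1` on
the curve. On the other hand the complement of the curve is connected, and the relation "`a` and
`b` are the poles of a map equal to `1` outside a compact set which does not meet the curve" is
an equivalence relation with open classes (`exists_hasIndex_pairIndex_of_isPreconnected`). The
quotient of the two maps has index `0` everywhere, i.e. it is continuous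
(`exists_continuous_crossing`).

For indices to be well defined, positions of singularities must be compared in coordinates of the
same orientation, and this is where the area form enters: a complex coordinate `ψ` is positive if
`{Re ψ, Im ψ} < 0`, an open condition since the bracket is continuous
(`continuousAt_poissonBracket`). Two positive coordinates at a point differ, to first order, by a map
`v ↦ α v + β v̄` with `|β| < |α|`, whence the increments have the same direction up to a factor with
a continuous logarithm (`IsPositiveAt.exists_dir_eq`).

The degree on the curve is handled without lifts: a map of the circle which takes the value `-1`
once, crossing the real axis there, is compared with another one by subtracting the principal
arguments, whose jumps cancel (`CrossesNegOneAt.exists_eq_mul_exp`).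
-/

open Filter Topology

/-! ### Continuity of the Poisson bracket -/

section PoissonBracket

variable {M : Type*} [TopologicalSpace M] [ChartedSpace Plane M] [IsManifold (𝓡 2) ∞ M]

/-- The coordinate vector field `∂ᵢ` of the preferred chart at `p`. -/
noncomputable def coordField (p : M) (i : Fin 2) (b : M) : TangentSpace (𝓡 2) b :=
  (trivializationAt Plane (TangentSpace (𝓡 2)) p).symmL ℝ b (EuclideanSpace.single i 1 : Plane)

theorem contMDiffAt_coordField (p : M) (i : Fin 2) :
    ContMDiffAt (𝓡 2) ((𝓡 2).prod 𝓘(ℝ, Plane)) ∞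
      (fun b ↦ (⟨b, coordField p i b⟩ : TangentBundle (𝓡 2) M)) p := by
  have h := contMDiffAt_localFrame_of_mem (I := 𝓡 2) ∞
    (trivializationAt Plane (TangentSpace (𝓡 2) : M → Type _) p)
    (EuclideanSpace.basisFun (Fin 2) ℝ).toBasis i (FiberBundle.mem_baseSet_trivializationAt' p)
  refine h.congr_of_eventuallyEq ?_
  filter_upwards [(trivializationAt Plane (TangentSpace (𝓡 2) : M → Type _) p).open_baseSet.mem_nhds
    (FiberBundle.mem_baseSet_trivializationAt' p)] with b hb
  rw [Bundle.Trivialization.localFrame_apply_of_mem_baseSet _ _ hb]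
  simp [coordField, Bundle.Trivialization.basisAt]
  exact Bundle.Trivialization.symmL_apply _ hb _

theorem mvfderiv_coordField {p b : M} (hb : b ∈ (chartAt Plane p).source) {F : M → ℝ}
    (hF : MDifferentiableAt (𝓡 2) 𝓘(ℝ, ℝ) F b) (i : Fin 2) :
    mvfderiv (𝓡 2) F b (coordField p i b) =
      fderiv ℝ (F ∘ (extChartAt (𝓡 2) p).symm) (extChartAt (𝓡 2) p b)
        (EuclideanSpace.single i 1) := by
  have hb' : (extChartAt (𝓡 2) p).symm (extChartAt (𝓡 2) p b) = b :=
    (extChartAt (𝓡 2) p).left_inv (by simpa using hb)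
  have hs := mdifferentiableWithinAt_extChartAt_symm (I := 𝓡 2) (x := p)
    (z := extChartAt (𝓡 2) p b) (by simp [hb])
  unfold coordField
  rw [TangentBundle.symmL_trivializationAt hb]
  have h2 := mvfderiv_comp_mfderivWithin_of_eq (I := 𝓘(ℝ, Plane)) (I' := 𝓡 2)
    (s := range (𝓡 2)) (g := F) hF hs
    (by simp [uniqueMDiffWithinAt_univ]) hb'
  have h3 := congrArg (fun L ↦ L (EuclideanSpace.single i (1 : ℝ) : Plane)) h2
  refine h3.symm.trans ?_
  have hr : range (𝓡 2) = univ := by simp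
  rw [hr, mvfderivWithin_univ]
  unfold mvfderiv
  rw [mfderiv_eq_fderiv]
  rfl

theorem continuousAt_mvfderiv_coordField {p : M} {F : M → ℝ}
    (hF : ContMDiffAt (𝓡 2) 𝓘(ℝ, ℝ) ∞ F p) (i : Fin 2) :
    ContinuousAt (fun b ↦ mvfderiv (𝓡 2) F b (coordField p i b)) p := by
  have h1 : ContDiffAt ℝ ∞ (F ∘ (extChartAt (𝓡 2) p).symm) (extChartAt (𝓡 2) p p) := by
    rw [← contMDiffAt_iff_contDiffAt]
    refine ContMDiffAt.comp_of_eq hF ?_ ((extChartAt (𝓡 2) p).left_inv (mem_extChartAt_source p))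
    exact (contMDiffOn_extChartAt_symm p).contMDiffAt (extChartAt_target_mem_nhds p)
  have h2 : ContinuousAt (fun b ↦ fderiv ℝ (F ∘ (extChartAt (𝓡 2) p).symm) (extChartAt (𝓡 2) p b)
      (EuclideanSpace.single i 1)) p := by
    have h3 := (h1.fderiv_right (m := 0) (by simp)).continuousAt
    exact (h3.comp (continuousAt_extChartAt p)).clm_apply continuousAt_const
  refine h2.congr ?_
  filter_upwards [chart_source_mem_nhds Plane p,
    contMDiffAt_iff_contMDiffAt_nhds (by simp) |>.1 (hF.of_le (m := 1) (by simp))] with b hb hFb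
  exact (mvfderiv_coordField hb (hFb.mdifferentiableAt (by simp)) i).symm

theorem continuousAt_form_coordField (Ω : SymplecticForm M) (p : M) (i j : Fin 2) :
    ContinuousAt (fun b ↦ Ω.form b (coordField p i b) (coordField p j b)) p := by
  have h := ContMDiffAt.clm_bundle_apply₂ (E₃ := fun _ : M ↦ ℝ) (F₃ := ℝ)
      (b := fun x : M ↦ x) (Ω.smooth p)
    (contMDiffAt_coordField p i) (contMDiffAt_coordField p j)
  have h2 := ((Bundle.contMDiffAt_section _).1 h).continuousAt
  exact h2

/-- The Poisson bracket of two smooth functions is continuous. -/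
theorem continuousAt_poissonBracket (Ω : SymplecticForm M) {p : M} {F G : M → ℝ}
    (hF : ContMDiffAt (𝓡 2) 𝓘(ℝ, ℝ) ∞ F p) (hG : ContMDiffAt (𝓡 2) 𝓘(ℝ, ℝ) ∞ G p) :
    ContinuousAt (poissonBracket Ω F G) p := by
  have hd := continuousAt_form_coordField Ω p 0 1
  have hne : Ω.form p (coordField p 0 p) (coordField p 1 p) ≠ 0 := by
    have : ∀ i, coordField p i p = tangentBasis p i := by
      intro i
      unfold coordField tangentBasis
      rw [TangentBundle.symmL_trivializationAt_eq_core (mem_chart_source Plane p)]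
      exact (tangentBundleCore (𝓡 2) M).coordChange_self (achart Plane p) p (mem_chart_source Plane p) _
    rw [this, this]
    exact Ω.form_basis_ne_zero p
  have hw : ContinuousAt (fun b ↦ -wedgeDifferentials F G b (coordField p 0 b) (coordField p 1 b) /
      Ω.form b (coordField p 0 b) (coordField p 1 b)) p := by
    unfold wedgeDifferentials
    exact ((((continuousAt_mvfderiv_coordField hF 0).mul (continuousAt_mvfderiv_coordField hG 1)).sub
      ((continuousAt_mvfderiv_coordField hF 1).mul (continuousAt_mvfderiv_coordField hG 0))).neg).div hd hne
  refine hw.congr ?_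
  filter_upwards [hd.eventually_ne hne] with b hb
  rw [← poissonBracket_mul_form]
  field_simp

end PoissonBracket

/-! ### Linear maps of the plane -/

/-- The determinant of a linear map from the model plane to `ℂ`. -/
noncomputable def planeDet (A : Plane →L[ℝ] ℂ) : ℝ :=
  (A (EuclideanSpace.single 0 1)).re * (A (EuclideanSpace.single 1 1)).im -
    (A (EuclideanSpace.single 1 1)).re * (A (EuclideanSpace.single 0 1)).im

theorem plane_map_apply (A : Plane →L[ℝ] ℂ) (v : Plane) :
    A v = v 0 • A (EuclideanSpace.single 0 1) + v 1 • A (EuclideanSpace.single 1 1) := by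
  have h : v = v 0 • EuclideanSpace.single (0 : Fin 2) (1 : ℝ) +
      v 1 • EuclideanSpace.single (1 : Fin 2) (1 : ℝ) := by
    ext i
    fin_cases i <;> simp
  conv_lhs => rw [h]
  simp only [map_add, map_smul]

theorem injective_of_planeDet_ne_zero {A : Plane →L[ℝ] ℂ} (hA : planeDet A ≠ 0) :
    Function.Injective A := by
  rw [injective_iff_map_eq_zero]
  intro v hv
  rw [plane_map_apply] at hv
  have h1 := congrArg Complex.re hv
  have h2 := congrArg Complex.im hv
  simp only [Complex.add_re, Complex.real_smul, Complex.re_ofReal_mul, Complex.zero_re,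
    Complex.add_im, Complex.im_ofReal_mul, Complex.zero_im] at h1 h2
  unfold planeDet at hA
  ext i
  fin_cases i
  · have : v 0 * planeDet A = 0 := by
        unfold planeDet
        linear_combination (A (EuclideanSpace.single 1 1)).im * h1 -
          (A (EuclideanSpace.single 1 1)).re * h2
    simpa [planeDet, hA] using this
  · have : v 1 * planeDet A = 0 := by
        unfold planeDet
        linear_combination (A (EuclideanSpace.single 0 1)).re * h2 -
          (A (EuclideanSpace.single 0 1)).im * h1
    simpa [planeDet, hA] using this

theorem planeDet_ne_zero_of_injective {A : Plane →L[ℝ] ℂ} (hA : Function.Injective A) :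
    planeDet A ≠ 0 := by
  intro h0
  unfold planeDet at h0
  have key : ∀ a b : ℝ, a • A (EuclideanSpace.single 0 1) + b • A (EuclideanSpace.single 1 1) = 0 →
      a = 0 ∧ b = 0 := by
    intro a b hab
    have h1 : A !₂[a, b] = A 0 := by rw [plane_map_apply]; simpa using hab
    have h2 := hA h1
    exact ⟨by simpa using congrArg (fun v : Plane ↦ v 0) h2,
      by simpa using congrArg (fun v : Plane ↦ v 1) h2⟩
  have h1 := key (A (EuclideanSpace.single 1 1)).im (-(A (EuclideanSpace.single 0 1)).im) (by
    apply Complex.ext <;> simp <;> linarith)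
  have h2 := key (A (EuclideanSpace.single 1 1)).re (-(A (EuclideanSpace.single 0 1)).re) (by
    apply Complex.ext <;> simp <;> linarith)
  have h3 := key 1 0 (by apply Complex.ext <;> simp <;> linarith)
  exact one_ne_zero h3.1

/-- If `A` and `B` induce the same orientation, then `A v = α (B v) + β conj (B v)` with
`‖β‖ < ‖α‖`. -/
theorem exists_norm_sub_mul_le {A B : Plane →L[ℝ] ℂ} (h : 0 < planeDet A * planeDet B) :
    ∃ (a : ℂ) (k : ℝ), 0 ≤ k ∧ k < ‖a‖ ∧ ∀ v, ‖A v - a * B v‖ ≤ k * ‖B v‖ := by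
  set r := A (EuclideanSpace.single 0 1) with hr
  set s := A (EuclideanSpace.single 1 1) with hs
  set p := B (EuclideanSpace.single 0 1) with hp
  set q := B (EuclideanSpace.single 1 1) with hq
  set D : ℂ := p * (starRingEnd ℂ) q - q * (starRingEnd ℂ) p with hD
  have hdB : planeDet B ≠ 0 := by rintro h0; simp [h0] at h
  have hDne : D ≠ 0 := by
    intro h0
    apply hdB
    have := congrArg Complex.im h0
    simp [hD] at this
    simp only [planeDet, ← hp, ← hq]
    linarith
  set a : ℂ := (r * (starRingEnd ℂ) q - s * (starRingEnd ℂ) p) / D with ha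
  set b : ℂ := (p * s - q * r) / D with hb
  refine ⟨a, ‖b‖, norm_nonneg _, ?_, fun v ↦ ?_⟩
  · rw [ha, hb, norm_div, norm_div]
    have hDpos : 0 < ‖D‖ := norm_pos_iff.2 hDne
    refine div_lt_div_of_pos_right ?_ hDpos
    refine lt_of_pow_lt_pow_left₀ 2 (norm_nonneg _) ?_
    rw [← Complex.normSq_eq_norm_sq, ← Complex.normSq_eq_norm_sq, Complex.normSq_apply,
      Complex.normSq_apply]
    simp only [planeDet, ← hp, ← hq, ← hr, ← hs] at h
    simp
    nlinarith
  · have key : A v - a * B v = b * (starRingEnd ℂ) (B v) := by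
      have h1 : r = a * p + b * (starRingEnd ℂ) p := by
        rw [ha, hb]; field_simp; rw [hD]; ring
      have h2 : s = a * q + b * (starRingEnd ℂ) q := by
        rw [ha, hb]; field_simp; rw [hD]; ring
      rw [plane_map_apply A v, plane_map_apply B v, ← hr, ← hs, ← hp, ← hq]
      simp only [map_add, Complex.real_smul, map_mul, Complex.conj_ofReal]
      linear_combination (v 0 : ℂ) * h1 + (v 1 : ℂ) * h2
    rw [key, norm_mul, RCLike.norm_conj]

/-- Two maps to `ℂ` whose differentials at `x` induce the same orientation
have, up to a complex factor, increments of comparable direction. -/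
theorem eventually_norm_sub_mul_lt {f g : Plane → ℂ} {A B : Plane →L[ℝ] ℂ} {x : Plane}
    (hf : HasFDerivAt f A x) (hg : HasFDerivAt g B x) (h : 0 < planeDet A * planeDet B) :
    ∃ a : ℂ, a ≠ 0 ∧ ∀ᶠ y in 𝓝[≠] x,
      ‖(f y - f x) - a * (g y - g x)‖ < ‖a * (g y - g x)‖ := by
  obtain ⟨a, k, hk, hka, hA⟩ := exists_norm_sub_mul_le h
  have ha : a ≠ 0 := by
    rintro rfl
    simp at hka
    linarith
  refine ⟨a, ha, ?_⟩
  have hinj : Function.Injective B := injective_of_planeDet_ne_zero (by rintro h0; simp [h0] at h)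
  obtain ⟨K, hK, hBK⟩ := B.toLinearMap.exists_antilipschitzWith (LinearMap.ker_eq_bot.2 hinj)
  have hO : (fun y ↦ y - x) =O[𝓝 x] fun y ↦ B (y - x) := by
    refine Asymptotics.IsBigO.of_bound K (Eventually.of_forall fun y ↦ ?_)
    simpa using hBK.le_mul_dist (y - x) 0
  have hf' := (hasFDerivAt_iff_isLittleO.1 hf).trans_isBigO hO
  have hg' := (hasFDerivAt_iff_isLittleO.1 hg).trans_isBigO hO
  set d : ℝ := (‖a‖ - k) / (2 * (1 + 2 * ‖a‖)) with hd
  have hapos : 0 < ‖a‖ := norm_pos_iff.2 ha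
  have hdpos : 0 < d := div_pos (by linarith) (by positivity)
  have hd2 : d * (1 + 2 * ‖a‖) = (‖a‖ - k) / 2 := by rw [hd]; field_simp
  filter_upwards [nhdsWithin_le_nhds (hf'.bound hdpos), nhdsWithin_le_nhds (hg'.bound hdpos),
    self_mem_nhdsWithin] with y h1 h2 hne
  set b := B (y - x) with hb
  have hbpos : 0 < ‖b‖ := by
    rw [norm_pos_iff, hb]
    intro h0
    exact hne (sub_eq_zero.1 (hinj (by simpa using h0)))
  have h3 : ‖b‖ ≤ ‖g y - g x‖ + d * ‖b‖ := by
    calc ‖b‖ = ‖(g y - g x) - (g y - g x - b)‖ := by congr 1; ring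
      _ ≤ _ := (norm_sub_le _ _).trans (by gcongr)
  have h4 : ‖(f y - f x) - a * (g y - g x)‖ ≤ d * ‖b‖ + k * ‖b‖ + ‖a‖ * (d * ‖b‖) := by
    calc ‖(f y - f x) - a * (g y - g x)‖
        = ‖(f y - f x - A (y - x)) + (A (y - x) - a * b) - a * (g y - g x - b)‖ := by
          congr 1; ring
      _ ≤ ‖f y - f x - A (y - x)‖ + ‖A (y - x) - a * b‖ + ‖a‖ * ‖g y - g x - b‖ := by
          refine (norm_sub_le _ _).trans ?_
          rw [norm_mul]
          gcongr
          exact norm_add_le _ _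
      _ ≤ _ := by gcongr; exact hA _
  rw [norm_mul]
  have h5 : ‖a‖ * ‖b‖ ≤ ‖a‖ * ‖g y - g x‖ + ‖a‖ * (d * ‖b‖) := by nlinarith
  nlinarith [mul_pos (sub_pos.2 hka) hbpos]


/-! ### Positively oriented coordinates -/

section Positive

variable {M : Type*} [TopologicalSpace M] [ChartedSpace Plane M] [IsManifold (𝓡 2) ∞ M]

/-- A complex-valued function on the surface is a positive coordinate at `x` if it is smooth there
and its differential at `x` is an orientation preserving isomorphism, the surface being oriented by
`Ω`.  With the sign convention `{F, G} Ω = - dF ∧ dG` this says that the Poisson bracket of its real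
and imaginary parts is negative. -/
def IsPositiveAt (Ω : SymplecticForm M) (ψ : M → ℂ) (x : M) : Prop :=
  ContMDiffAt (𝓡 2) 𝓘(ℝ, ℂ) ∞ ψ x ∧
    poissonBracket Ω (fun y ↦ (ψ y).re) (fun y ↦ (ψ y).im) x < 0

omit [IsManifold (𝓡 2) ∞ M] in
theorem mvfderiv_comp_fderiv {g : M → ℂ} {φ : ℂ → ℝ} {x : M}
    (hg : MDifferentiableAt (𝓡 2) 𝓘(ℝ, ℂ) g x) (hφ : DifferentiableAt ℝ φ (g x))
    (v : TangentSpace (𝓡 2) x) :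
    mvfderiv (𝓡 2) (fun y ↦ φ (g y)) x v = fderiv ℝ φ (g x) (mvfderiv (𝓡 2) g x v) := by
  have h := (hφ.hasFDerivAt.hasMFDerivAt.comp x hg.hasMFDerivAt).mfderiv
  change mfderiv (𝓡 2) 𝓘(ℝ, ℝ) (fun y ↦ φ (g y)) x = _ at h
  unfold mvfderiv
  rw [h]
  rfl

omit [IsManifold (𝓡 2) ∞ M] in
theorem wedge_re_im {ψ : M → ℂ} {x : M} (h : MDifferentiableAt (𝓡 2) 𝓘(ℝ, ℂ) ψ x) :
    wedgeDifferentials (fun y ↦ (ψ y).re) (fun y ↦ (ψ y).im) x (tangentBasis x 0)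
      (tangentBasis x 1) = planeDet (mvfderiv (𝓡 2) ψ x) := by
  unfold wedgeDifferentials planeDet
  have h1 := mvfderiv_comp_fderiv h Complex.reCLM.differentiableAt
  have h2 := mvfderiv_comp_fderiv h Complex.imCLM.differentiableAt
  simp only [ContinuousLinearMap.fderiv, Complex.reCLM_apply, Complex.imCLM_apply] at h1 h2
  rw [h1, h1, h2, h2]
  rfl

omit [IsManifold (𝓡 2) ∞ M] in
theorem hasFDerivAt_comp_chart {ψ : M → ℂ} {x : M} (h : MDifferentiableAt (𝓡 2) 𝓘(ℝ, ℂ) ψ x) :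
    HasFDerivAt (ψ ∘ (chartAt Plane x).symm) (mvfderiv (𝓡 2) ψ x : Plane →L[ℝ] ℂ)
      (chartAt Plane x x) := by
  have h1 := h.hasMFDerivAt.2
  simp only [mfld_simps] at h1
  exact h1.hasFDerivAt univ_mem

theorem IsPositiveAt.planeDet_mul_pos {Ω : SymplecticForm M} {ψ : M → ℂ} {x : M}
    (h : IsPositiveAt Ω ψ x) :
    0 < planeDet (mvfderiv (𝓡 2) ψ x) * Ω.form x (tangentBasis x 0) (tangentBasis x 1) := by
  have h1 := h.2
  have hne := Ω.form_basis_ne_zero x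
  rw [poissonBracket, wedge_re_im (h.1.mdifferentiableAt (by simp)), neg_div, neg_lt_zero] at h1
  rw [div_eq_mul_inv] at h1
  have h2 := mul_pos h1 (mul_self_pos.2 hne)
  field_simp at h2
  exact h2

/-- Two positive coordinates at a point have increments of comparable direction. -/
theorem IsPositiveAt.eventually_norm_sub_mul_lt {Ω : SymplecticForm M} {ψ χ : M → ℂ} {x : M}
    (h : IsPositiveAt Ω ψ x) (h' : IsPositiveAt Ω χ x) :
    ∃ a : ℂ, a ≠ 0 ∧ ∀ᶠ y in 𝓝[≠] x,
      ‖(ψ y - ψ x) - a * (χ y - χ x)‖ < ‖a * (χ y - χ x)‖ := by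
  obtain ⟨a, ha, hev⟩ := _root_.eventually_norm_sub_mul_lt
    (hasFDerivAt_comp_chart (h.1.mdifferentiableAt (by simp)))
    (hasFDerivAt_comp_chart (h'.1.mdifferentiableAt (by simp)))
    (by nlinarith [mul_pos h.planeDet_mul_pos h'.planeDet_mul_pos,
      sq_nonneg (Ω.form x (tangentBasis x 0) (tangentBasis x 1))])
  refine ⟨a, ha, ?_⟩
  have ht : Tendsto (chartAt Plane x) (𝓝[≠] x) (𝓝[≠] (chartAt Plane x x)) := by
    refine tendsto_nhdsWithin_iff.2 ⟨((chartAt Plane x).continuousAt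
      (mem_chart_source Plane x)).mono_left nhdsWithin_le_nhds, ?_⟩
    filter_upwards [nhdsWithin_le_nhds (chart_source_mem_nhds Plane x), self_mem_nhdsWithin]
      with y hy hne
    exact fun h ↦ hne ((chartAt Plane x).injOn hy (mem_chart_source Plane x) h)
  filter_upwards [ht.eventually hev, nhdsWithin_le_nhds (chart_source_mem_nhds Plane x)]
    with y hy hys
  simpa [(chartAt Plane x).left_inv hys, (chartAt Plane x).left_inv (mem_chart_source Plane x)]
    using hy

/-- Being a positive coordinate is an open condition. -/
theorem eventually_poissonBracket_neg {Ω : SymplecticForm M} {ψ : M → ℂ} {x : M}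
    (h : IsPositiveAt Ω ψ x) :
    ∀ᶠ y in 𝓝 x, poissonBracket Ω (fun y ↦ (ψ y).re) (fun y ↦ (ψ y).im) y < 0 :=
  (continuousAt_poissonBracket Ω (Complex.reCLM.contMDiff.contMDiffAt.comp x h.1)
    (Complex.imCLM.contMDiff.contMDiffAt.comp x h.1)).eventually_lt continuousAt_const h.2

/-- A chart composed with a linear isomorphism `Plane → ℂ`, or with its
complex conjugate, is a positive coordinate. -/
theorem isPositiveAt_or_conj (Ω : SymplecticForm M) {e : OpenPartialHomeomorph M Plane}
    (he : e ∈ IsManifold.maximalAtlas (𝓡 2) ∞ M) {x : M} (hx : x ∈ e.source)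
    (L : Plane ≃L[ℝ] ℂ) :
    IsPositiveAt Ω (fun y ↦ L (e y)) x ∨
      IsPositiveAt Ω (fun y ↦ (L.trans Complex.conjCLE) (e y)) x := by
  have hes : ContMDiffAt (𝓡 2) (𝓡 2) ∞ e x :=
    (contMDiffOn_of_mem_maximalAtlas he).contMDiffAt (e.open_source.mem_nhds hx)
  have hs : ∀ L : Plane ≃L[ℝ] ℂ, ContMDiffAt (𝓡 2) 𝓘(ℝ, ℂ) ∞ (fun y ↦ L (e y)) x := fun L ↦
    L.contDiff.contMDiff.contMDiffAt.comp x hes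
  have hd := (hs L).mdifferentiableAt (by simp)
  have hinj : Function.Injective (mvfderiv (𝓡 2) (fun y ↦ L (e y)) x) := by
    have h1 : OpenPartialHomeomorph.MDifferentiable (𝓡 2) (𝓡 2) e :=
      ⟨(contMDiffOn_of_mem_maximalAtlas he).mdifferentiableOn (by simp),
        (contMDiffOn_symm_of_mem_maximalAtlas he).mdifferentiableOn (by simp)⟩
    have h2 := h1.mfderiv_injective hx
    have h3 := (L.toContinuousLinearMap.hasMFDerivAt (x := e x)).comp x
      (hes.mdifferentiableAt (by simp)).hasMFDerivAt
    have h4 := h3.mfderiv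
    change mfderiv (𝓡 2) 𝓘(ℝ, ℂ) (fun y ↦ L (e y)) x = _ at h4
    unfold mvfderiv
    rw [h4]
    exact L.injective.comp h2
  set A : Plane →L[ℝ] ℂ := mvfderiv (𝓡 2) (fun y ↦ L (e y)) x with hA
  have hdet : planeDet A ≠ 0 := by
    exact planeDet_ne_zero_of_injective hinj
  have hne : poissonBracket Ω (fun y ↦ (L (e y)).re) (fun y ↦ (L (e y)).im) x ≠ 0 := by
    rw [poissonBracket, wedge_re_im hd]
    exact div_ne_zero (neg_ne_zero.2 hdet) (Ω.form_basis_ne_zero x)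
  rcases lt_or_gt_of_ne hne with h | h
  · exact Or.inl ⟨hs L, h⟩
  · refine Or.inr ⟨hs _, ?_⟩
    have h1 : poissonBracket Ω (fun y ↦ ((L.trans Complex.conjCLE) (e y)).re)
        (fun y ↦ ((L.trans Complex.conjCLE) (e y)).im) x =
        - poissonBracket Ω (fun y ↦ (L (e y)).re) (fun y ↦ (L (e y)).im) x := by
      simp only [ContinuousLinearEquiv.trans_apply, Complex.conjCLE_apply, Complex.conj_re,
        Complex.conj_im, poissonBracket, wedgeDifferentials]
      have : mvfderiv (𝓡 2) (fun y ↦ -(L (e y)).im) x = -mvfderiv (𝓡 2) (fun y ↦ (L (e y)).im) x :=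
        mvfderiv_neg
      rw [this]
      simp only [_root_.neg_apply]
      ring
    rw [h1]
    linarith

/-- Every chart can be turned into a positive chart with values in `ℂ` on a small open set,
by composing with a given linear isomorphism `Plane → ℂ` or with its conjugate. -/
theorem exists_positive_chart (Ω : SymplecticForm M) {e : OpenPartialHomeomorph M Plane}
    (he : e ∈ IsManifold.maximalAtlas (𝓡 2) ∞ M) {x : M} (hx : x ∈ e.source)
    (L : Plane ≃L[ℝ] ℂ) :
    ∃ (ψ : OpenPartialHomeomorph M ℂ) (T : Plane ≃L[ℝ] ℂ),
      (T = L ∨ T = L.trans Complex.conjCLE) ∧ x ∈ ψ.source ∧ ψ.source ⊆ e.source ∧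
      (∀ y, ψ y = T (e y)) ∧ ∀ y ∈ ψ.source, IsPositiveAt Ω ψ y := by
  obtain ⟨T, hT, hpos⟩ : ∃ T : Plane ≃L[ℝ] ℂ, (T = L ∨ T = L.trans Complex.conjCLE) ∧
      IsPositiveAt Ω (fun y ↦ T (e y)) x := by
    rcases isPositiveAt_or_conj Ω he hx L with h | h
    exacts [⟨L, Or.inl rfl, h⟩, ⟨_, Or.inr rfl, h⟩]
  obtain ⟨U, hU, hUo, hxU⟩ := eventually_nhds_iff.1 (eventually_poissonBracket_neg hpos)
  refine ⟨(e.transHomeomorph T.toHomeomorph).restr U, T, hT, ?_, ?_, ?_, ?_⟩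
  · simp [hUo.interior_eq, hx, hxU]
  · simp
  · simp
  · intro y hy
    simp only [OpenPartialHomeomorph.restr_source, hUo.interior_eq] at hy
    refine ⟨?_, hU y hy.2⟩
    exact T.contDiff.contMDiff.contMDiffAt.comp y
      ((contMDiffOn_of_mem_maximalAtlas he).contMDiffAt (e.open_source.mem_nhds hy.1))

end Positive

/-! ### Directions of complex numbers -/

/-- The direction `z / |z|` of a complex number, as a point of the circle (`1` for `z = 0`). -/
noncomputable def dir (z : ℂ) : Circle := Circle.exp z.arg

theorem coe_dir {z : ℂ} (hz : z ≠ 0) : (dir z : ℂ) = z / ‖z‖ := by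
  have h := Complex.norm_mul_exp_arg_mul_I z
  have hz' : (‖z‖ : ℂ) ≠ 0 := by simpa using hz
  rw [dir, Circle.coe_exp, eq_div_iff hz', mul_comm]
  exact h

@[simp]
theorem dir_zero : dir 0 = 1 := by simp [dir]

theorem dir_mul {z w : ℂ} (hz : z ≠ 0) (hw : w ≠ 0) : dir (z * w) = dir z * dir w := by
  apply Circle.ext
  rw [Circle.coe_mul, coe_dir hz, coe_dir hw, coe_dir (mul_ne_zero hz hw), norm_mul]
  push_cast
  field_simp

theorem dir_div {z w : ℂ} (hz : z ≠ 0) (hw : w ≠ 0) : dir (z / w) = dir z / dir w := by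
  rw [eq_div_iff_mul_eq', ← dir_mul (div_ne_zero hz hw) hw, div_mul_cancel₀ _ hw]

theorem dir_coe (z : Circle) : dir z = z := by
  simp [dir]

theorem continuousAt_dir {z : ℂ} (hz : z ≠ 0) : ContinuousAt dir z := by
  have hi : @IsInducing Circle ℂ _ _ (fun z : Circle ↦ (z : ℂ)) := ⟨rfl⟩
  refine hi.continuousAt_iff.2 ?_
  have : ContinuousAt (fun w : ℂ ↦ w / (‖w‖ : ℂ)) z :=
    continuousAt_id.div (Complex.continuous_ofReal.continuousAt.comp continuous_norm.continuousAt)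
      (by simpa using hz)
  refine this.congr ?_
  filter_upwards [isOpen_ne.mem_nhds hz] with w hw
  exact (coe_dir hw).symm

/-- A circle-valued map continuous on a neighbourhood of a point has a real-valued logarithm which
is continuous on a neighbourhood of that point. -/
theorem exists_log_of_continuousAt {X : Type*} [TopologicalSpace X] {G : X → Circle} {a : X}
    (ha : ContinuousAt G a) :
    ∃ u : X → ℝ, (∀ y, G y = Circle.exp (u y)) ∧
      ∀ᶠ y in 𝓝 a, ContinuousAt G y → ContinuousAt u y := by
  refine ⟨fun y ↦ Complex.arg (G y / G a : Circle) + Complex.arg (G a), fun y ↦ ?_, ?_⟩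
  · rw [Circle.exp_add]
    change G y = dir (G y / G a : Circle) * dir (G a)
    rw [dir_coe, dir_coe]
    simp
  · have h1 : ContinuousAt (fun y ↦ ((G y / G a : Circle) : ℂ)) a :=
      continuous_subtype_val.continuousAt.comp (ha.div' continuousAt_const)
    have h2 : ∀ᶠ y in 𝓝 a, ((G y / G a : Circle) : ℂ) ∈ Complex.slitPlane :=
      h1.eventually (Complex.isOpen_slitPlane.mem_nhds (by simp))
    filter_upwards [h2] with y hy hGy
    refine ContinuousAt.add ?_ continuousAt_const
    exact (Complex.continuousAt_arg hy).comp (f := fun y ↦ ((G y / G a : Circle) : ℂ))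
      (continuous_subtype_val.continuousAt.comp (hGy.div' continuousAt_const))

theorem mem_slitPlane_of_norm_sub_one_lt {q : ℂ} (h : ‖q - 1‖ < 1) : q ∈ Complex.slitPlane := by
  left
  have := (abs_lt.1 ((Complex.abs_re_le_norm (q - 1)).trans_lt h)).1
  simp at this
  linarith

/-! ### The index of a circle-valued map at a point -/

section Index

variable {M : Type*} [TopologicalSpace M] [ChartedSpace Plane M] [IsManifold (𝓡 2) ∞ M]

theorem exists_isPositiveAt (Ω : SymplecticForm M) (x : M) : ∃ ψ : M → ℂ, IsPositiveAt Ω ψ x := by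
  obtain ⟨ψ, T, -, hx, -, -, h⟩ := exists_positive_chart Ω
    (IsManifold.chart_mem_maximalAtlas (I := 𝓡 2) (n := ∞) x) (mem_chart_source Plane x)
    (Complex.orthonormalBasisOneI.repr.symm.toContinuousLinearEquiv)
  exact ⟨ψ, h x hx⟩

/-- The direction, in a positive coordinate centred at `x`, of the point `y` seen from `x`.
It is a junk value at `y = x` and outside the domain of the coordinate: only its germ at `x`, off
`x` itself, matters. -/
noncomputable def dirFrom (Ω : SymplecticForm M) (x y : M) : Circle :=
  dir ((exists_isPositiveAt Ω x).choose y - (exists_isPositiveAt Ω x).choose x)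

/-- The map `H` has index `n` at `x`: near `x` it is the `n`-th power of the direction from `x`, up
to a factor with a continuous logarithm.  The value at `x` itself is included, where the
direction is `1` by convention. Hence index `0` means continuity. -/
def HasIndex (Ω : SymplecticForm M) (H : M → Circle) (x : M) (n : ℤ) : Prop :=
  ∃ u : M → ℝ, ContinuousAt u x ∧ ∀ᶠ y in 𝓝 x, H y = dirFrom Ω x y ^ n * Circle.exp (u y)

variable {Ω : SymplecticForm M} {H H' : M → Circle} {x : M} {m n : ℤ}

theorem HasIndex.mul (h : HasIndex Ω H x m) (h' : HasIndex Ω H' x n) :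
    HasIndex Ω (H * H') x (m + n) := by
  obtain ⟨u, hu, h⟩ := h
  obtain ⟨v, hv, h'⟩ := h'
  refine ⟨u + v, hu.add hv, ?_⟩
  filter_upwards [h, h'] with y h1 h2
  rw [Pi.mul_apply, h1, h2, zpow_add, Pi.add_apply, Circle.exp_add]
  exact mul_mul_mul_comm _ _ _ _

theorem HasIndex.inv (h : HasIndex Ω H x m) : HasIndex Ω H⁻¹ x (-m) := by
  obtain ⟨u, hu, h⟩ := h
  refine ⟨-u, hu.neg, ?_⟩
  filter_upwards [h] with y h1
  rw [Pi.inv_apply, h1, zpow_neg, Pi.neg_apply, Circle.exp_neg, mul_inv]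

theorem hasIndex_zero_iff : HasIndex Ω H x 0 ↔ ContinuousAt H x := by
  refine ⟨fun ⟨u, hu, h⟩ ↦ ?_, fun h ↦ ?_⟩
  · refine (Circle.exp.continuous.continuousAt.comp hu).congr ?_
    filter_upwards [h] with y hy
    simp [hy]
  · obtain ⟨u, hu, hc⟩ := exists_log_of_continuousAt h
    exact ⟨u, hc.self_of_nhds h, Eventually.of_forall fun y ↦ by simp [hu y]⟩

theorem HasIndex.congr (h : HasIndex Ω H x n) (hH : H' =ᶠ[𝓝 x] H) : HasIndex Ω H' x n := by
  obtain ⟨u, hu, h⟩ := h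
  refine ⟨u, hu, ?_⟩
  filter_upwards [h, hH] with y h1 h2
  rw [h2, h1]

theorem IsPositiveAt.eventually_continuousAt {ψ : M → ℂ} (h : IsPositiveAt Ω ψ x) :
    ∀ᶠ y in 𝓝 x, ContinuousAt ψ y := by
  filter_upwards [(contMDiffAt_iff_contMDiffAt_nhds (by simp)).1 (h.1.of_le (m := 1) (by simp))]
    with y hy using hy.continuousAt

/-- The direction of the increments of a positive coordinate agrees with `dirFrom`
up to a factor with a continuous logarithm on a punctured neighbourhood. -/
theorem IsPositiveAt.exists_dir_eq {ψ : M → ℂ} (h : IsPositiveAt Ω ψ x) :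
    ∃ u : M → ℝ, ∀ᶠ y in 𝓝[≠] x, ContinuousAt u y ∧
      dir (ψ y - ψ x) = dirFrom Ω x y * Circle.exp (u y) := by
  have h' := (exists_isPositiveAt Ω x).choose_spec
  set χ := (exists_isPositiveAt Ω x).choose with hχ
  obtain ⟨a, ha, hev⟩ := h.eventually_norm_sub_mul_lt h'
  refine ⟨fun y ↦ Complex.arg ((ψ y - ψ x) / (a * (χ y - χ x))) + Complex.arg a, ?_⟩
  filter_upwards [hev, nhdsWithin_le_nhds h.eventually_continuousAt,
    nhdsWithin_le_nhds h'.eventually_continuousAt] with y hy hψ hχc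
  have hd : a * (χ y - χ x) ≠ 0 := norm_pos_iff.1 ((norm_nonneg _).trans_lt hy)
  have hq : (ψ y - ψ x) / (a * (χ y - χ x)) ∈ Complex.slitPlane := by
    apply mem_slitPlane_of_norm_sub_one_lt
    rw [div_sub_one hd, norm_div]
    exact (div_lt_one (norm_pos_iff.2 hd)).2 hy
  refine ⟨?_, ?_⟩
  · refine ContinuousAt.add ?_ continuousAt_const
    exact (Complex.continuousAt_arg hq).comp (f := fun y ↦ (ψ y - ψ x) / (a * (χ y - χ x)))
      ((hψ.sub continuousAt_const).div (continuousAt_const.mul (hχc.sub continuousAt_const)) hd)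
  · have hχ0 : χ y - χ x ≠ 0 := right_ne_zero_of_mul hd
    have h1 : ψ y - ψ x = ((ψ y - ψ x) / (a * (χ y - χ x)) * a) * (χ y - χ x) := by
      field_simp
    have hq0 := Complex.slitPlane_ne_zero hq
    conv_lhs => rw [h1]
    rw [dir_mul (mul_ne_zero hq0 ha) hχ0, dir_mul hq0 ha, Circle.exp_add, dirFrom, ← hχ, mul_comm]
    rfl

omit [IsManifold (𝓡 2) ∞ M] in
/-- A function may be multiplied by a cut-off near `a` so as to stay continuous outside `a`. -/
theorem exists_cutoff_mul [T2Space M] {w : M → ℝ} {a : M} {N : Set M} (hN : N ∈ 𝓝 a)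
    (hw : ∀ᶠ y in 𝓝[≠] a, ContinuousAt w y) :
    ∃ c : M → ℝ, (∀ᶠ y in 𝓝 a, c y = w y) ∧ (∀ y ∉ N, c y = 0) ∧ ∀ y, y ≠ a → ContinuousAt c y := by
  have : LocallyCompactSpace M := ChartedSpace.locallyCompactSpace Plane M
  obtain ⟨O, hO, hOo, haO⟩ := eventually_nhds_iff.1
    ((eventually_nhdsWithin_iff.1 hw).and (eventually_mem_set.2 hN))
  obtain ⟨K, hKc, haK, hKO⟩ := exists_compact_subset hOo haO
  obtain ⟨K', hK'c, haK', hK'K⟩ := exists_compact_subset isOpen_interior haK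
  obtain ⟨χ, h1, h0, -, -⟩ := exists_continuous_one_zero_of_isCompact hK'c
    (isOpen_interior (s := K)).isClosed_compl (disjoint_compl_right_iff_subset.2 hK'K)
  refine ⟨fun y ↦ χ y * w y, ?_, ?_, ?_⟩
  · filter_upwards [mem_interior_iff_mem_nhds.1 haK'] with y hy
    simp [h1 hy]
  · intro y hy
    have : χ y = 0 := h0 fun hyK ↦ hy (hO y (hKO (interior_subset hyK))).2
    simp [this]
  · intro y hy
    by_cases hyO : y ∈ O
    · exact χ.continuous.continuousAt.mul ((hO y hyO).1 hy)
    · have hyK : y ∈ Kᶜ := fun h ↦ hyO (hKO h)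
      refine continuousAt_const.congr (f := fun _ ↦ (0 : ℝ)) ?_
      filter_upwards [hKc.isClosed.isOpen_compl.mem_nhds hyK] with z hz
      have : χ z = 0 := h0 fun h ↦ hz (interior_subset h)
      simp [this]

/-- A map which winds `n` times around `a` can be modified close to `a` so as to have
index `n` there. -/
theorem exists_hasIndex_of_dir_eq [T2Space M] {H₀ G : M → Circle} {a : M} {ψ : M → ℂ}
    (hψ : IsPositiveAt Ω ψ a) (hG : ∀ᶠ y in 𝓝 a, ContinuousAt G y)
    (hH₀ : ∀ᶠ y in 𝓝[≠] a, H₀ y = dir (ψ y - ψ a) ^ n * G y) {N : Set M} (hN : N ∈ 𝓝 a) :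
    ∃ H : M → Circle, HasIndex Ω H a n ∧ (∀ y ∉ N, H y = H₀ y) ∧
      ∀ y, y ≠ a → ∀ m, HasIndex Ω H₀ y m → HasIndex Ω H y m := by
  classical
  obtain ⟨u, hu⟩ := hψ.exists_dir_eq
  obtain ⟨v, hv, hvc⟩ := exists_log_of_continuousAt hG.self_of_nhds
  obtain ⟨c, hca, hcN, hcc⟩ := exists_cutoff_mul (w := fun y ↦ n * u y + v y) hN (by
    filter_upwards [hu, nhdsWithin_le_nhds hvc, nhdsWithin_le_nhds hG] with y h1 h2 h3
    exact (continuousAt_const.mul h1.1).add (h2 h3))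
  refine ⟨fun y ↦ if y = a then 1 else H₀ y * Circle.exp (-c y), ?_, ?_, ?_⟩
  · refine ⟨fun _ ↦ 0, continuousAt_const, ?_⟩
    filter_upwards [hca, eventually_nhdsWithin_iff.1 hu, eventually_nhdsWithin_iff.1 hH₀]
      with y h1 h2 h3
    by_cases hy : y = a
    · simp [hy, dirFrom]
    · have h2' := (h2 hy).2
      rw [if_neg hy, h3 hy, h2', h1, hv y, mul_zpow, ← Circle.exp_intCast_mul]
      simp [Circle.exp_add, Circle.exp_neg, mul_assoc]
  · intro y hy
    have : y ≠ a := fun h ↦ hy (h ▸ mem_of_mem_nhds hN)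
    simp [this, hcN y hy]
  · intro y hy m hm
    have h1 : HasIndex Ω (fun z ↦ Circle.exp (-c z)) y 0 :=
      hasIndex_zero_iff.2 (Circle.exp.continuous.continuousAt.comp (hcc y hy).neg)
    have h2 := hm.mul h1
    rw [add_zero] at h2
    refine h2.congr ?_
    filter_upwards [isOpen_ne.mem_nhds hy] with z hz
    simp [show z ≠ a from hz]

end Index

/-! ### Pairs of opposite indices -/

/-- A cut-off at `1`: equal to `1` on the disc of radius `1/4` and to `0` outside the disc of
radius `1/2`. -/
noncomputable def cutoffAtOne (w : ℂ) : ℝ := max 0 (min 1 (2 - 4 * ‖w - 1‖))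

theorem continuous_cutoffAtOne : Continuous cutoffAtOne := by
  unfold cutoffAtOne
  fun_prop

theorem cutoffAtOne_eq_one {w : ℂ} (h : ‖w - 1‖ ≤ 1 / 4) : cutoffAtOne w = 1 := by
  rw [cutoffAtOne, min_eq_left (by linarith), max_eq_right zero_le_one]

theorem cutoffAtOne_eq_zero {w : ℂ} (h : 1 / 2 ≤ ‖w - 1‖) : cutoffAtOne w = 0 := by
  rw [cutoffAtOne]
  exact max_eq_left ((min_le_right _ _).trans (by linarith))

/-- The direction map, flattened to the constant `1` near the point `1`. -/
noncomputable def flatDir (w : ℂ) : Circle := dir w * Circle.exp (-(cutoffAtOne w * w.arg))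

theorem flatDir_eq_one {w : ℂ} (h : ‖w - 1‖ ≤ 1 / 4) : flatDir w = 1 := by
  rw [flatDir, cutoffAtOne_eq_one h, dir, ← Circle.exp_add]
  simp

theorem flatDir_eq_dir {w : ℂ} (h : 1 / 2 ≤ ‖w - 1‖) : flatDir w = dir w := by
  rw [flatDir, cutoffAtOne_eq_zero h]
  simp

theorem flatDir_eq_exp (w : ℂ) : flatDir w = Circle.exp ((1 - cutoffAtOne w) * w.arg) := by
  rw [flatDir, dir, ← Circle.exp_add]
  congr 1
  ring

theorem continuousAt_flatDir {w : ℂ} (hw : w ≠ 0) : ContinuousAt flatDir w := by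
  refine (continuousAt_dir hw).mul (Circle.exp.continuous.continuousAt.comp (ContinuousAt.neg ?_))
  by_cases h : ‖w - 1‖ < 1
  · exact continuous_cutoffAtOne.continuousAt.mul
      (Complex.continuousAt_arg (mem_slitPlane_of_norm_sub_one_lt h))
  · refine continuousAt_const.congr (f := fun _ ↦ (0 : ℝ)) ?_
    have : ∀ᶠ z : ℂ in 𝓝 w, 1 / 2 < ‖z - 1‖ :=
      continuousAt_const.eventually_lt (by fun_prop) (by linarith)
    filter_upwards [this] with z hz
    simp [cutoffAtOne_eq_zero hz.le]

section Pair

variable {M : Type*} [TopologicalSpace M]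

open Classical in
/-- The model of a map with index `1` at `a` and index `-1` at `b`: in the chart `ψ` it is the
direction of `(z - ψ a) / (z - ψ b)`, flattened so as to be `1` far away from `a` and `b`. -/
noncomputable def pairMap (ψ : OpenPartialHomeomorph M ℂ) (a b y : M) : Circle :=
  if y ∈ ψ.source then flatDir ((ψ y - ψ a) / (ψ y - ψ b)) else 1

variable {ψ : OpenPartialHomeomorph M ℂ} {a b : M}

theorem pairMap_of_mem {y : M} (hy : y ∈ ψ.source) :
    pairMap ψ a b y = flatDir ((ψ y - ψ a) / (ψ y - ψ b)) := if_pos hy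

/-- The compact set outside which `pairMap` is constant. -/
def pairSupport (ψ : OpenPartialHomeomorph M ℂ) (a b : M) : Set M :=
  ψ.symm '' Metric.closedBall (ψ b) (4 * ‖ψ a - ψ b‖)

theorem isCompact_pairSupport (h : Metric.closedBall (ψ b) (4 * ‖ψ a - ψ b‖) ⊆ ψ.target) :
    IsCompact (pairSupport ψ a b) :=
  (isCompact_closedBall _ _).image_of_continuousOn (ψ.continuousOn_symm.mono h)

theorem pairSupport_subset (h : Metric.closedBall (ψ b) (4 * ‖ψ a - ψ b‖) ⊆ ψ.target) :
    pairSupport ψ a b ⊆ ψ.source := by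
  rintro _ ⟨z, hz, rfl⟩
  exact ψ.map_target (h hz)

theorem mem_interior_pairSupport {y : M} (hy : y ∈ ψ.source)
    (h : ‖ψ y - ψ b‖ < 4 * ‖ψ a - ψ b‖) : y ∈ interior (pairSupport ψ a b) := by
  rw [mem_interior_iff_mem_nhds]
  have h1 : ∀ᶠ z in 𝓝 y, ‖ψ z - ψ b‖ < 4 * ‖ψ a - ψ b‖ :=
    ((ψ.continuousAt hy).sub continuousAt_const).norm.eventually_lt continuousAt_const h
  filter_upwards [h1, ψ.open_source.mem_nhds hy] with z hz hzs
  exact ⟨ψ z, by simpa [dist_eq_norm] using hz.le, ψ.left_inv hzs⟩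

theorem pairMap_eq_one {y : M} (hab : ψ a ≠ ψ b) (hy : y ∉ pairSupport ψ a b) :
    pairMap ψ a b y = 1 := by
  unfold pairMap
  split_ifs with hys
  · apply flatDir_eq_one
    have h1 : 4 * ‖ψ a - ψ b‖ < ‖ψ y - ψ b‖ := by
      by_contra! h
      exact hy ⟨ψ y, by simpa [dist_eq_norm] using h, ψ.left_inv hys⟩
    have h2 : 0 < ‖ψ a - ψ b‖ := norm_pos_iff.2 (sub_ne_zero.2 hab)
    have h3 : 0 < ‖ψ y - ψ b‖ := by linarith
    rw [div_sub_one (norm_pos_iff.1 h3), norm_div, div_le_iff₀ h3,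
      show ψ y - ψ a - (ψ y - ψ b) = -(ψ a - ψ b) by ring, norm_neg]
    linarith
  · rfl

theorem continuousAt_pairMap_of_mem {y : M} (hy : y ∈ ψ.source) (ha : ψ y ≠ ψ a) (hb : ψ y ≠ ψ b) :
    ContinuousAt (pairMap ψ a b) y := by
  have h1 : ContinuousAt (fun y ↦ flatDir ((ψ y - ψ a) / (ψ y - ψ b))) y :=
    (continuousAt_flatDir (div_ne_zero (sub_ne_zero.2 ha) (sub_ne_zero.2 hb))).comp
      (f := fun y ↦ (ψ y - ψ a) / (ψ y - ψ b))
      (((ψ.continuousAt hy).sub continuousAt_const).div ((ψ.continuousAt hy).sub continuousAt_const)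
        (sub_ne_zero.2 hb))
  refine h1.congr ?_
  filter_upwards [ψ.open_source.mem_nhds hy] with z hz
  exact (pairMap_of_mem hz).symm

theorem continuousAt_pairMap [T2Space M] (ha : a ∈ ψ.source) (hb : b ∈ ψ.source) (hab : a ≠ b)
    (h : Metric.closedBall (ψ b) (4 * ‖ψ a - ψ b‖) ⊆ ψ.target) {y : M} (hya : y ≠ a) (hyb : y ≠ b) :
    ContinuousAt (pairMap ψ a b) y := by
  by_cases hy : y ∈ ψ.source
  · exact continuousAt_pairMap_of_mem hy (fun h ↦ hya (ψ.injOn hy ha h))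
      (fun h ↦ hyb (ψ.injOn hy hb h))
  · have hy' : y ∈ (pairSupport ψ a b)ᶜ := fun h' ↦ hy (pairSupport_subset h h')
    refine continuousAt_const.congr (f := fun _ ↦ (1 : Circle)) ?_
    filter_upwards [(isCompact_pairSupport h).isClosed.isOpen_compl.mem_nhds hy'] with z hz
    exact (pairMap_eq_one (fun h' ↦ hab (ψ.injOn ha hb h')) hz).symm

/-- Near `a`, the map `pairMap` is the direction from `a` up to a factor which is
continuous there. -/
theorem pairMap_near_left (ha : a ∈ ψ.source) (hb : b ∈ ψ.source) (hab : a ≠ b) :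
    ∀ᶠ y in 𝓝[≠] a, pairMap ψ a b y = dir (ψ y - ψ a) ^ (1 : ℤ) * (dir (ψ y - ψ b))⁻¹ := by
  have hne : ψ a - ψ b ≠ 0 := sub_ne_zero.2 fun h ↦ hab (ψ.injOn ha hb h)
  have hc : ContinuousAt (fun y ↦ (ψ y - ψ a) / (ψ y - ψ b)) a :=
    ((ψ.continuousAt ha).sub continuousAt_const).div ((ψ.continuousAt ha).sub continuousAt_const) hne
  have h1 : ∀ᶠ y in 𝓝 a, 1 / 2 < ‖(ψ y - ψ a) / (ψ y - ψ b) - 1‖ :=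
    continuousAt_const.eventually_lt (hc.sub continuousAt_const).norm (by norm_num)
  filter_upwards [nhdsWithin_le_nhds h1, nhdsWithin_le_nhds (ψ.open_source.mem_nhds ha),
    nhdsWithin_le_nhds (((ψ.continuousAt ha).sub continuousAt_const).eventually_ne hne),
    self_mem_nhdsWithin] with y h2 h3 h4 h5
  replace h4 : ψ y - ψ b ≠ 0 := h4
  rw [pairMap_of_mem h3, flatDir_eq_dir h2.le,
    dir_div (sub_ne_zero.2 fun h ↦ h5 (ψ.injOn h3 ha h)) h4, zpow_one, div_eq_mul_inv]

/-- Near `b`, the map `pairMap` is the inverse of the direction from `b` up to a factor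
which is continuous there. -/
theorem pairMap_near_right (ha : a ∈ ψ.source) (hb : b ∈ ψ.source) (hab : a ≠ b) :
    ∀ᶠ y in 𝓝[≠] b, pairMap ψ a b y = dir (ψ y - ψ b) ^ (-1 : ℤ) * dir (ψ y - ψ a) := by
  have hne : ψ b - ψ a ≠ 0 := sub_ne_zero.2 fun h ↦ hab (ψ.injOn ha hb h.symm)
  have h1 : ∀ᶠ y in 𝓝 b, ‖ψ y - ψ b‖ < 2 * ‖ψ b - ψ a‖ :=
    ((ψ.continuousAt hb).sub continuousAt_const).norm.eventually_lt continuousAt_const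
      (by simpa using hne)
  filter_upwards [nhdsWithin_le_nhds h1, nhdsWithin_le_nhds (ψ.open_source.mem_nhds hb),
    nhdsWithin_le_nhds (((ψ.continuousAt hb).sub continuousAt_const).eventually_ne hne),
    self_mem_nhdsWithin] with y h2 h3 h4 h5
  replace h4 : ψ y - ψ a ≠ 0 := h4
  have h6 : ψ y - ψ b ≠ 0 := sub_ne_zero.2 fun h ↦ h5 (ψ.injOn h3 hb h)
  rw [pairMap_of_mem h3, flatDir_eq_dir, dir_div h4 h6, zpow_neg_one, div_eq_mul_inv, mul_comm]
  rw [div_sub_one h6, norm_div, le_div_iff₀ (norm_pos_iff.2 h6),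
    show ψ y - ψ a - (ψ y - ψ b) = ψ b - ψ a by ring]
  linarith

end Pair

section PairIndex

variable {M : Type*} [TopologicalSpace M] [ChartedSpace Plane M] [IsManifold (𝓡 2) ∞ M]

open Classical in
/-- The function with value `1` at `a`, `-1` at `b` and `0` elsewhere (and `0` everywhere if
`a = b`). -/
noncomputable def pairIndex (a b x : M) : ℤ := (if x = a then 1 else 0) - (if x = b then 1 else 0)

variable {Ω : SymplecticForm M}

/-- The map `pairMap`, corrected near `a` and `b` so that its indices are defined there too. -/
theorem exists_hasIndex_pairIndex [T2Space M] {ψ : OpenPartialHomeomorph M ℂ}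
    (hψ : ∀ y ∈ ψ.source, IsPositiveAt Ω ψ y) {a b : M} (ha : a ∈ ψ.source) (hb : b ∈ ψ.source)
    (hab : a ≠ b) (h : Metric.closedBall (ψ b) (4 * ‖ψ a - ψ b‖) ⊆ ψ.target)
    {Na Nb : Set M} (hNa : Na ∈ 𝓝 a) (hNb : Nb ∈ 𝓝 b) :
    ∃ H : M → Circle, (∀ x, HasIndex Ω H x (pairIndex a b x)) ∧
      (∀ y ∉ pairSupport ψ a b, H y = 1) ∧ ∀ y ∉ Na ∪ Nb, H y = pairMap ψ a b y := by
  have hne : ψ a ≠ ψ b := fun h' ↦ hab (ψ.injOn ha hb h')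
  have hpos : 0 < ‖ψ a - ψ b‖ := norm_pos_iff.2 (sub_ne_zero.2 hne)
  obtain ⟨Ua, Ub, hUa, hUb, haU, hbU, hUab⟩ := t2_separation hab
  have hNa' : Na ∩ Ua ∩ interior (pairSupport ψ a b) ∈ 𝓝 a :=
    inter_mem (inter_mem hNa (hUa.mem_nhds haU))
      (isOpen_interior.mem_nhds (mem_interior_pairSupport ha (by linarith)))
  have hNb' : Nb ∩ interior (pairSupport ψ a b) ∈ 𝓝 b :=
    inter_mem hNb (isOpen_interior.mem_nhds (mem_interior_pairSupport hb (by simpa using hpos)))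
  obtain ⟨H₁, h1a, h1N, h1⟩ := exists_hasIndex_of_dir_eq (hψ a ha)
    (G := fun y ↦ (dir (ψ y - ψ b))⁻¹) (by
      filter_upwards [ψ.open_source.mem_nhds ha, isOpen_ne.mem_nhds hab] with y hy hyb
      have : ψ y - ψ b ≠ 0 := sub_ne_zero.2 fun h' ↦ hyb (ψ.injOn hy hb h')
      exact ((continuousAt_dir this).comp (f := fun y ↦ ψ y - ψ b)
        ((ψ.continuousAt hy).sub continuousAt_const)).inv)
    (pairMap_near_left ha hb hab) hNa'
  obtain ⟨H₂, h2b, h2N, h2⟩ := exists_hasIndex_of_dir_eq (H₀ := H₁) (n := -1) (hψ b hb)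
    (G := fun y ↦ dir (ψ y - ψ a)) (by
      filter_upwards [ψ.open_source.mem_nhds hb, isOpen_ne.mem_nhds hab.symm] with y hy hya
      have : ψ y - ψ a ≠ 0 := sub_ne_zero.2 fun h' ↦ hya (ψ.injOn hy ha h')
      exact (continuousAt_dir this).comp (f := fun y ↦ ψ y - ψ a)
        ((ψ.continuousAt hy).sub continuousAt_const))
    (by
      filter_upwards [pairMap_near_right ha hb hab, nhdsWithin_le_nhds (hUb.mem_nhds hbU)]
        with y hy hyU
      rw [h1N y fun h' ↦ hUab.notMem_of_mem_right hyU h'.1.2, hy]) hNb'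
  refine ⟨H₂, fun x ↦ ?_, fun y hy ↦ ?_, fun y hy ↦ ?_⟩
  · by_cases hxb : x = b
    · simpa [pairIndex, hxb, hab.symm] using h2b
    · refine h2 x hxb _ ?_
      by_cases hxa : x = a
      · simpa [pairIndex, hxa, hab] using h1a
      · refine h1 x hxa _ ?_
        simpa [pairIndex, hxa, hxb] using
          hasIndex_zero_iff.2 (continuousAt_pairMap ha hb hab h hxa hxb)
  · rw [h2N y fun h' ↦ hy (interior_subset h'.2), h1N y fun h' ↦ hy (interior_subset h'.2),
      pairMap_eq_one hne hy]
  · rw [h2N y fun h' ↦ hy (Or.inr h'.1), h1N y fun h' ↦ hy (Or.inl h'.1.1)]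

/-- In a connected open set `W`, any two points are the poles of a map which is `1` outside a
compact subset of `W`. -/
theorem exists_hasIndex_pairIndex_of_isPreconnected [T2Space M] {W : Set M} (hW : IsOpen W)
    (hWc : IsPreconnected W) {a b : M} (ha : a ∈ W) (hb : b ∈ W) :
    ∃ H : M → Circle, (∀ x, HasIndex Ω H x (pairIndex a b x)) ∧
      ∃ K ⊆ W, IsCompact K ∧ ∀ y ∉ K, H y = 1 := by
  refine hWc.induction₂ (fun a b ↦ ∃ H : M → Circle, (∀ x, HasIndex Ω H x (pairIndex a b x)) ∧
      ∃ K ⊆ W, IsCompact K ∧ ∀ y ∉ K, H y = 1) ?_ ?_ ?_ ha hb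
  · intro x hx
    obtain ⟨ψ₀, T, -, hx₀, -, -, hpos⟩ := exists_positive_chart Ω
      (IsManifold.chart_mem_maximalAtlas (I := 𝓡 2) (n := ∞) x) (mem_chart_source Plane x)
      (Complex.orthonormalBasisOneI.repr.symm.toContinuousLinearEquiv)
    set ψ := ψ₀.restr W with hψ
    have hψs : ψ.source = ψ₀.source ∩ W := by simp [hψ, hW.interior_eq]
    have hxs : x ∈ ψ.source := hψs ▸ ⟨hx₀, hx⟩
    obtain ⟨r, hr, hball⟩ := Metric.isOpen_iff.1 ψ.open_target _ (ψ.map_source hxs)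
    have hev : ∀ᶠ y in 𝓝 x, ‖ψ x - ψ y‖ < r / 5 :=
      (continuousAt_const.sub (ψ.continuousAt hxs)).norm.eventually_lt continuousAt_const
        (by simpa using hr)
    filter_upwards [nhdsWithin_le_nhds hev, nhdsWithin_le_nhds (ψ.open_source.mem_nhds hxs)]
      with y hy hys
    by_cases hxy : x = y
    · subst hxy
      refine ⟨1, fun z ↦ ?_, ∅, empty_subset _, isCompact_empty, fun _ _ ↦ rfl⟩
      rw [show pairIndex x x z = 0 by simp [pairIndex]]
      exact hasIndex_zero_iff.2 continuousAt_const
    have hsub : Metric.closedBall (ψ y) (4 * ‖ψ x - ψ y‖) ⊆ ψ.target := by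
      refine (Metric.closedBall_subset_ball' ?_).trans hball
      rw [dist_comm, dist_eq_norm]
      linarith
    obtain ⟨H, hH, h1, -⟩ := exists_hasIndex_pairIndex (ψ := ψ)
      (fun z hz ↦ hpos z (by rw [hψs] at hz; exact hz.1)) hxs hys hxy hsub univ_mem univ_mem
    refine ⟨H, hH, pairSupport ψ x y, ?_, isCompact_pairSupport hsub, h1⟩
    exact (pairSupport_subset hsub).trans (hψs ▸ inter_subset_right)
  · rintro x y z - - - ⟨H, hH, K, hKW, hK, h1⟩ ⟨H', hH', K', hKW', hK', h1'⟩
    refine ⟨H * H', fun w ↦ ?_, K ∪ K', union_subset hKW hKW', hK.union hK', fun w hw ↦ ?_⟩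
    · have := (hH w).mul (hH' w)
      simpa [pairIndex] using this
    · rw [Pi.mul_apply, h1 w fun h ↦ hw (Or.inl h), h1' w fun h ↦ hw (Or.inr h), one_mul]
  · rintro x y - - ⟨H, hH, K, hKW, hK, h1⟩
    refine ⟨H⁻¹, fun w ↦ ?_, K, hKW, hK, fun w hw ↦ ?_⟩
    · have := (hH w).inv
      simpa [pairIndex] using this
    · rw [Pi.inv_apply, h1 w hw, inv_one]

end PairIndex

/-! ### Circle-valued maps passing once through `-1` -/

/-- The map `m` takes a value in the closed negative half-axis only at `exp (i t)`, where it passes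
through `-1` from the upper to the lower half-plane as the angle increases. -/
structure CrossesNegOneAt (m : Circle → Circle) (t : ℝ) : Prop where
  continuous : Continuous m
  eq_neg_one : (m (Circle.exp t) : ℂ) = -1
  mem_slitPlane : ∀ η, η ≠ Circle.exp t → (m η : ℂ) ∈ Complex.slitPlane
  eventually_neg : ∀ᶠ θ in 𝓝[≠] t, (θ - t) * (m (Circle.exp θ) : ℂ).im < 0

/-- Two maps which pass through `-1` once, at the same point and in the same direction,
differ by a factor with a continuous logarithm. -/
theorem CrossesNegOneAt.exists_eq_mul_exp {m k : Circle → Circle} {t : ℝ}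
    (hm : CrossesNegOneAt m t) (hk : CrossesNegOneAt k t) :
    ∃ u : C(Circle, ℝ), ∀ η, k η = m η * Circle.exp (u η) := by
  have hcoe : ∀ {f : Circle → Circle} (_ : Continuous f) (η : Circle),
      ContinuousAt (fun η ↦ (f η : ℂ)) η := fun hf η ↦
    (continuous_subtype_val.comp hf).continuousAt
  have hu : Continuous fun η ↦ (k η : ℂ).arg - (m η : ℂ).arg := by
    rw [continuous_iff_continuousAt]
    intro η
    by_cases hη : η = Circle.exp t
    · subst hη
      -- Near the crossing point the jumps of the two arguments cancel: both arguments may be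
      -- replaced by those of the opposite numbers, which are close to `1`.
      have h1 : ∀ᶠ θ in 𝓝 t, (-(k (Circle.exp θ) : ℂ)).arg - (-(m (Circle.exp θ) : ℂ)).arg =
          (k (Circle.exp θ) : ℂ).arg - (m (Circle.exp θ) : ℂ).arg := by
        filter_upwards [eventually_nhdsWithin_iff.1 hm.eventually_neg,
          eventually_nhdsWithin_iff.1 hk.eventually_neg] with θ h1 h2
        by_cases hθ : θ = t
        · rw [hθ, hm.eq_neg_one, hk.eq_neg_one]
          simp
        · replace h1 := h1 hθ
          replace h2 := h2 hθ
          rcases lt_or_gt_of_ne (sub_ne_zero.2 hθ) with h | h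
          · rw [Complex.arg_neg_eq_arg_sub_pi_of_im_pos (by nlinarith),
              Complex.arg_neg_eq_arg_sub_pi_of_im_pos (by nlinarith)]
            ring
          · rw [Complex.arg_neg_eq_arg_add_pi_of_im_neg (by nlinarith),
              Complex.arg_neg_eq_arg_add_pi_of_im_neg (by nlinarith)]
            ring
      have h2 : ∀ {f : Circle → Circle} (_ : CrossesNegOneAt f t),
          ContinuousAt (fun η ↦ (-(f η : ℂ)).arg) (Circle.exp t) := fun {f} hf ↦
        (Complex.continuousAt_arg (by simp [hf.eq_neg_one])).comp (f := fun η ↦ -(f η : ℂ))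
          (hcoe hf.continuous _).neg
      refine ((h2 hk).sub (h2 hm)).congr ?_
      rw [EventuallyEq, ← isLocalHomeomorph_circleExp.map_nhds_eq t]
      exact h1
    · have h2 : ∀ {f : Circle → Circle} (_ : CrossesNegOneAt f t),
          ContinuousAt (fun η ↦ (f η : ℂ).arg) η := fun {f} hf ↦
        (Complex.continuousAt_arg (hf.mem_slitPlane η hη)).comp (f := fun η ↦ (f η : ℂ))
          (hcoe hf.continuous η)
      exact (h2 hk).sub (h2 hm)
  refine ⟨⟨_, hu⟩, fun η ↦ ?_⟩
  have h1 : Circle.exp (k η : ℂ).arg = k η := dir_coe _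
  have h2 : Circle.exp (m η : ℂ).arg = m η := dir_coe _
  change k η = m η * Circle.exp ((k η : ℂ).arg - (m η : ℂ).arg)
  rw [Circle.exp_sub, h1, h2, mul_div_cancel]

/-! ### The square of a divided circle -/

theorem mem_circleSegment_union (s t : ℝ) (η : Circle) :
    η ∈ circleSegment s t ∪ circleSegment t (s + 2 * Real.pi) := by
  obtain ⟨θ, hθ, h⟩ := Circle.periodic_exp.exists_mem_Ico Real.two_pi_pos (η : ℂ).arg s
  rw [Circle.exp_arg] at h
  rcases le_total θ t with h1 | h1
  · exact Or.inl ⟨θ, ⟨hθ.1, h1⟩, h.symm⟩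
  · exact Or.inr ⟨θ, ⟨h1, hθ.2.le⟩, h.symm⟩

theorem eq_of_mem_circleSegment_inter {s t : ℝ} {η : Circle} (h : η ∈ circleSegment s t)
    (h' : η ∈ circleSegment t (s + 2 * Real.pi)) : η = Circle.exp s ∨ η = Circle.exp t := by
  obtain ⟨θ, hθ, rfl⟩ := h
  obtain ⟨θ', hθ', he⟩ := h'
  obtain ⟨n, hn⟩ := Circle.exp_eq_exp.1 he
  have hp := Real.two_pi_pos
  have h0 : -1 < n := by
    by_contra! h
    have : (n : ℝ) ≤ -1 := by exact_mod_cast h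
    nlinarith [hθ.2, hθ'.1]
  have h1 : n ≤ 1 := by
    by_contra! h
    have : (2 : ℝ) ≤ n := by exact_mod_cast h
    nlinarith [hθ.1, hθ'.2]
  obtain rfl | rfl : n = 0 ∨ n = 1 := by omega
  · right
    congr 1
    push_cast at hn
    linarith [hθ.2, hθ'.1]
  · left
    congr 1
    push_cast at hn
    linarith [hθ.1, hθ'.2]

/-- The difference of the distances to the two arcs cut out by the angles `s` and `t`; it is
positive inside the arc from `s` to `t` and negative inside the other one. -/
noncomputable def arcHeight (s t : ℝ) (η : Circle) : ℝ :=
  Metric.infDist η (circleSegment t (s + 2 * Real.pi)) - Metric.infDist η (circleSegment s t)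

theorem continuous_arcHeight (s t : ℝ) : Continuous (arcHeight s t) :=
  (Metric.continuous_infDist_pt _).sub (Metric.continuous_infDist_pt _)

theorem arcHeight_nonneg {s t : ℝ} {η : Circle} (h : η ∈ circleSegment s t) :
    0 ≤ arcHeight s t η := by
  rw [arcHeight, Metric.infDist_zero_of_mem h, sub_zero]
  exact Metric.infDist_nonneg

theorem arcHeight_nonpos {s t : ℝ} {η : Circle} (h : η ∈ circleSegment t (s + 2 * Real.pi)) :
    arcHeight s t η ≤ 0 := by
  rw [arcHeight, Metric.infDist_zero_of_mem h, zero_sub, neg_nonpos]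
  exact Metric.infDist_nonneg

theorem isClosed_circleSegment (s t : ℝ) : IsClosed (circleSegment s t) :=
  (isCompact_Icc.image Circle.exp.continuous).isClosed

theorem eq_of_arcHeight_eq_zero {s t : ℝ} (h : s ≤ t) (h' : t ≤ s + 2 * Real.pi) {η : Circle}
    (h0 : arcHeight s t η = 0) : η = Circle.exp s ∨ η = Circle.exp t := by
  have hne : (circleSegment s t).Nonempty := (nonempty_Icc.2 h).image _
  have hne' : (circleSegment t (s + 2 * Real.pi)).Nonempty := (nonempty_Icc.2 h').image _
  rcases mem_circleSegment_union s t η with h1 | h1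
  · refine eq_of_mem_circleSegment_inter h1
      ((isClosed_circleSegment _ _).mem_iff_infDist_zero hne' |>.2 ?_)
    rwa [arcHeight, Metric.infDist_zero_of_mem h1, sub_zero] at h0
  · refine eq_of_mem_circleSegment_inter
      ((isClosed_circleSegment _ _).mem_iff_infDist_zero hne |>.2 ?_) h1
    rwa [arcHeight, Metric.infDist_zero_of_mem h1, zero_sub, neg_eq_zero] at h0

theorem circleExp_ne {s t : ℝ} (h : s < t) (h' : t < s + 2 * Real.pi) :
    Circle.exp t ≠ Circle.exp s := by
  intro he
  obtain ⟨n, hn⟩ := Circle.exp_eq_exp.1 he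
  have hp := Real.two_pi_pos
  have h0 : 0 < n := by
    by_contra! h
    have : (n : ℝ) ≤ 0 := by exact_mod_cast h
    nlinarith
  have h1 : (1 : ℝ) ≤ n := by exact_mod_cast h0
  nlinarith

theorem circleSegment_mono {s t s' t' : ℝ} (h : s' ≤ s) (h' : t ≤ t') :
    circleSegment s t ⊆ circleSegment s' t' := image_mono (Icc_subset_Icc h h')

theorem circleSegment_add_two_pi (s t : ℝ) :
    circleSegment (s + 2 * Real.pi) (t + 2 * Real.pi) = circleSegment s t := by
  ext η
  constructor
  · rintro ⟨θ, hθ, rfl⟩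
    exact ⟨θ - 2 * Real.pi, ⟨by linarith [hθ.1], by linarith [hθ.2]⟩, Circle.exp_sub_two_pi θ⟩
  · rintro ⟨θ, hθ, rfl⟩
    exact ⟨θ + 2 * Real.pi, ⟨by linarith [hθ.1], by linarith [hθ.2]⟩, Circle.exp_add_two_pi θ⟩

/-- A circle divided into four segments maps to the unit circle in such a way that the segments go
to the four closed quadrants (in the order fourth, first, second, third) and that only
one division point goes to `-1`. -/
theorem exists_map_to_quadrants {t : Fin 4 → ℝ} (ht : StrictMono t)
    (ht' : t 3 < t 0 + 2 * Real.pi) :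
    ∃ k : Circle → Circle, CrossesNegOneAt k (t 3) ∧
      (∀ η ∈ circleSegment (t 0) (t 1), 0 ≤ (k η : ℂ).re ∧ (k η : ℂ).im ≤ 0) ∧
      (∀ η ∈ circleSegment (t 1) (t 2), 0 ≤ (k η : ℂ).re ∧ 0 ≤ (k η : ℂ).im) ∧
      (∀ η ∈ circleSegment (t 2) (t 3), (k η : ℂ).re ≤ 0 ∧ 0 ≤ (k η : ℂ).im) ∧
      (∀ η ∈ circleSegment (t 3) (t 0 + 2 * Real.pi), (k η : ℂ).re ≤ 0 ∧ (k η : ℂ).im ≤ 0) := by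
  have h01 : t 0 < t 1 := ht (by decide)
  have h12 : t 1 < t 2 := ht (by decide)
  have h23 : t 2 < t 3 := ht (by decide)
  set X := arcHeight (t 0) (t 2) with hX
  set Y := arcHeight (t 1) (t 3) with hY
  have hX0 : ∀ η, X η = 0 → η = Circle.exp (t 0) ∨ η = Circle.exp (t 2) := fun η h ↦
    eq_of_arcHeight_eq_zero (by linarith) (by linarith) h
  have hY0 : ∀ η, Y η = 0 → η = Circle.exp (t 1) ∨ η = Circle.exp (t 3) := fun η h ↦
    eq_of_arcHeight_eq_zero (by linarith) (by linarith) h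
  have hX1 : 0 < X (Circle.exp (t 1)) := by
    refine lt_of_le_of_ne (arcHeight_nonneg ⟨t 1, ⟨h01.le, h12.le⟩, rfl⟩) fun h ↦ ?_
    rcases hX0 _ h.symm with h | h
    · exact circleExp_ne h01 (by linarith) h
    · exact circleExp_ne h12 (by linarith) h.symm
  have hX3 : X (Circle.exp (t 3)) < 0 := by
    refine lt_of_le_of_ne (arcHeight_nonpos ⟨t 3, ⟨h23.le, by linarith⟩, rfl⟩) fun h ↦ ?_
    rcases hX0 _ h with h | h
    · exact circleExp_ne (by linarith) (by linarith) h
    · exact circleExp_ne h23 (by linarith) h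
  have hY3 : Y (Circle.exp (t 3)) = 0 :=
    le_antisymm (arcHeight_nonpos ⟨t 3, ⟨le_rfl, by linarith⟩, rfl⟩)
      (arcHeight_nonneg ⟨t 3, ⟨by linarith, le_rfl⟩, rfl⟩)
  let Z : Circle → ℂ := fun η ↦ ⟨X η, Y η⟩
  have hZc : Continuous Z := by
    have : Z = fun η ↦ (X η : ℂ) + Y η * Complex.I := by
      ext η; exact (Complex.mk_eq_add_mul_I _ _)
    rw [this]
    exact (Complex.continuous_ofReal.comp (continuous_arcHeight _ _)).add
      ((Complex.continuous_ofReal.comp (continuous_arcHeight _ _)).mul continuous_const)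
  have hZ : ∀ η, Z η ≠ 0 := by
    intro η h
    have hx : X η = 0 := congrArg Complex.re h
    rcases hY0 η (congrArg Complex.im h) with h | h
    · exact hX1.ne' (h ▸ hx)
    · exact hX3.ne (h ▸ hx)
  have hpos : ∀ η, 0 < ‖Z η‖ := fun η ↦ norm_pos_iff.2 (hZ η)
  have hre : ∀ η, (dir (Z η) : ℂ).re = X η / ‖Z η‖ := fun η ↦ by
    rw [coe_dir (hZ η), Complex.div_ofReal_re]
  have him : ∀ η, (dir (Z η) : ℂ).im = Y η / ‖Z η‖ := fun η ↦ by
    rw [coe_dir (hZ η), Complex.div_ofReal_im]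
  have hXn : ∀ η ∈ circleSegment (t 2) (t 0 + 2 * Real.pi), X η ≤ 0 := fun η h ↦ arcHeight_nonpos h
  have hXp : ∀ η ∈ circleSegment (t 0) (t 2), 0 ≤ X η := fun η h ↦ arcHeight_nonneg h
  have hYn : ∀ η ∈ circleSegment (t 3) (t 1 + 2 * Real.pi), Y η ≤ 0 := fun η h ↦ arcHeight_nonpos h
  have hYp : ∀ η ∈ circleSegment (t 1) (t 3), 0 ≤ Y η := fun η h ↦ arcHeight_nonneg h
  refine ⟨fun η ↦ dir (Z η), ⟨?_, ?_, ?_, ?_⟩, ?_, ?_, ?_, ?_⟩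
  · exact continuous_iff_continuousAt.2 fun η ↦ (continuousAt_dir (hZ η)).comp hZc.continuousAt
  · have h1 : Z (Circle.exp (t 3)) = (X (Circle.exp (t 3)) : ℂ) := Complex.ext rfl hY3
    rw [h1, dir, Complex.arg_ofReal_of_neg hX3]
    simp
  · intro η hη
    by_cases hy : Y η = 0
    · left
      have : η = Circle.exp (t 1) := (hY0 η hy).resolve_right hη
      rw [hre, this]
      exact div_pos hX1 (hpos _)
    · right
      rw [him]
      exact div_ne_zero hy (hpos η).ne'
  · have hev : ∀ᶠ θ in 𝓝 (t 3), θ ∈ Ioo (t 1) (t 1 + 2 * Real.pi) :=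
      isOpen_Ioo.mem_nhds ⟨by linarith, by linarith⟩
    filter_upwards [nhdsWithin_le_nhds hev, self_mem_nhdsWithin] with θ h1 h2
    have hne : Y (Circle.exp θ) ≠ 0 := by
      intro h
      rcases hY0 _ h with h | h
      · exact circleExp_ne h1.1 h1.2 h
      · rcases lt_or_gt_of_ne h2 with h3 | h3
        · exact circleExp_ne h3 (by linarith [h1.1]) h.symm
        · exact circleExp_ne h3 (by linarith [h1.2]) h
    rw [him]
    rcases lt_or_gt_of_ne h2 with h3 | h3
    · have : 0 < Y (Circle.exp θ) := lt_of_le_of_ne (hYp _ ⟨θ, ⟨h1.1.le, h3.le⟩, rfl⟩) hne.symm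
      exact mul_neg_of_neg_of_pos (by linarith) (div_pos this (hpos _))
    · have : Y (Circle.exp θ) < 0 := lt_of_le_of_ne (hYn _ ⟨θ, ⟨h3.le, h1.2.le⟩, rfl⟩) hne
      exact mul_neg_of_pos_of_neg (by linarith) (div_neg_of_neg_of_pos this (hpos _))
  · intro η h
    rw [hre, him]
    refine ⟨div_nonneg (hXp η (circleSegment_mono le_rfl h12.le h)) (hpos η).le,
      div_nonpos_of_nonpos_of_nonneg (hYn η ?_) (hpos η).le⟩
    rw [← circleSegment_add_two_pi] at h
    exact circleSegment_mono (by linarith) le_rfl h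
  · intro η h
    rw [hre, him]
    exact ⟨div_nonneg (hXp η (circleSegment_mono h01.le le_rfl h)) (hpos η).le,
      div_nonneg (hYp η (circleSegment_mono le_rfl h23.le h)) (hpos η).le⟩
  · intro η h
    rw [hre, him]
    exact ⟨div_nonpos_of_nonpos_of_nonneg (hXn η (circleSegment_mono le_rfl ht'.le h)) (hpos η).le,
      div_nonneg (hYp η (circleSegment_mono h12.le le_rfl h)) (hpos η).le⟩
  · intro η h
    rw [hre, him]
    exact ⟨div_nonpos_of_nonpos_of_nonneg (hXn η (circleSegment_mono h23.le le_rfl h)) (hpos η).le,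
      div_nonpos_of_nonpos_of_nonneg (hYn η (circleSegment_mono le_rfl (by linarith) h)) (hpos η).le⟩

/-! ### A map crossing the curve once -/

theorem exists_linear_eq_one {w : Plane} (hw : w ≠ 0) : ∃ L : Plane ≃L[ℝ] ℂ, L w = 1 := by
  set L₀ : Plane ≃L[ℝ] ℂ := Complex.orthonormalBasisOneI.repr.symm.toContinuousLinearEquiv with hL
  have h0 : L₀ w ≠ 0 := by simpa using hw
  refine ⟨L₀.trans ((ContinuousLinearEquiv.unitsEquivAut ℂ (Units.mk0 _ h0)⁻¹).restrictScalars ℝ), ?_⟩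
  simp [h0]

section Crossing

variable {M : Type*} [TopologicalSpace M] [ChartedSpace Plane M] [IsManifold (𝓡 2) ∞ M]

/-- Near each of its points a smoothly embedded curve is contained in the real axis of a
suitable positive chart. -/
theorem exists_positive_slice_chart (Ω : SymplecticForm M) {α : Circle → M}
    (hα : IsSmoothEmbedding (𝓡 1) (𝓡 2) ∞ α) (ζ : Circle) :
    ∃ ψ : OpenPartialHomeomorph M ℂ, α ζ ∈ ψ.source ∧ (∀ y ∈ ψ.source, IsPositiveAt Ω ψ y) ∧
      ∀ η, α η ∈ ψ.source → (ψ (α η)).im = 0 := by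
  obtain ⟨F, _, _, hF⟩ := hα.isImmersion
  have h := hF ζ
  set w : Plane := h.equiv (EuclideanSpace.single 0 1, 0) with hw
  have hw0 : w ≠ 0 := by
    intro h0
    have h1 := congrArg Prod.fst ((map_eq_zero_iff _ h.equiv.injective).1 h0)
    have h2 := congrArg (fun v : EuclideanSpace ℝ (Fin 1) ↦ v 0) h1
    simp at h2
  obtain ⟨L, hL⟩ := exists_linear_eq_one hw0
  obtain ⟨ψ₀, T, hT, hζ, hsub, hψT, hpos⟩ := exists_positive_chart Ω h.codChart_mem_maximalAtlas
    h.mem_codChart_source L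
  have hTw : T w = 1 := by
    rcases hT with rfl | rfl
    · exact hL
    · simp [hL]
  obtain ⟨V, hV, hVd⟩ := hα.isEmbedding.isInducing.isOpen_iff.1 h.domChart.open_source
  have hψs : (ψ₀.restr V).source = ψ₀.source ∩ V := by simp [hV.interior_eq]
  refine ⟨ψ₀.restr V, ?_, fun y hy ↦ ?_, fun η hη ↦ ?_⟩
  · rw [hψs]
    exact ⟨hζ, by rw [← mem_preimage, hVd]; exact h.mem_domChart_source⟩
  · rw [hψs] at hy
    exact hpos y hy.1
  · rw [hψs] at hη
    have hd : η ∈ h.domChart.source := by rw [← hVd]; exact hη.2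
    have h1 : h.codChart (α η) = h.equiv (h.domChart η, 0) := by
      have := h.writtenInCharts (show h.domChart η ∈ (h.domChart.extend (𝓡 1)).target by
        simpa using h.domChart.map_source hd)
      simpa [h.domChart.left_inv hd] using this
    have h2 : ((h.domChart η, 0) : EuclideanSpace ℝ (Fin 1) × F) =
        (h.domChart η 0) • (EuclideanSpace.single 0 1, 0) := by
      ext i
      · fin_cases i; simp
      · simp
    change (ψ₀ (α η)).im = 0
    rw [hψT, h1, h2, map_smul, map_smul, ← hw, hTw]
    simp

/-- The direction seen along the real axis of the quotient `(z - iε) / (z + iε)`. -/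
theorem im_quotient {x ε : ℝ} :
    (((x : ℂ) - ε * Complex.I) / (x + ε * Complex.I)).im = -(2 * ε / (x ^ 2 + ε ^ 2)) * x := by
  simp [Complex.div_im, Complex.normSq_apply]
  ring

theorem flatDir_mem_slitPlane {w : ℂ} (hw : w ∈ Complex.slitPlane) :
    (flatDir w : ℂ) ∈ Complex.slitPlane := by
  have h1 := Complex.mem_slitPlane_iff_arg.1 hw
  have h2 : |w.arg| < Real.pi := abs_lt.2
    ⟨Complex.neg_pi_lt_arg w, lt_of_le_of_ne (Complex.arg_le_pi w) h1.1⟩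
  have h3 : |(1 - cutoffAtOne w) * w.arg| < Real.pi := by
    have h4 : 0 ≤ cutoffAtOne w := le_max_left _ _
    have h5 : cutoffAtOne w ≤ 1 := max_le zero_le_one (min_le_left _ _)
    rw [abs_mul, abs_of_nonneg (by linarith)]
    nlinarith [abs_nonneg w.arg]
  rw [abs_lt] at h3
  rw [flatDir_eq_exp, Complex.mem_slitPlane_iff_arg, Circle.arg_exp h3.1 h3.2.le]
  exact ⟨h3.2.ne, Circle.coe_ne_zero _⟩

/-- A non-separating curve is crossed by a circle-valued map without singularities which is `1`
outside a compact set and winds once along the curve. -/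
theorem exists_continuous_crossing [T2Space M] (Ω : SymplecticForm M) {α : Circle → M}
    (hα : IsSmoothEmbedding (𝓡 1) (𝓡 2) ∞ α) (hsep : IsConnected (range α)ᶜ) (t : ℝ) :
    ∃ H : M → Circle, Continuous H ∧ (∃ K : Set M, IsCompact K ∧ ∀ y ∉ K, H y = 1) ∧
      CrossesNegOneAt (H ∘ α) t := by
  have hαc : Continuous α := hα.isEmbedding.continuous
  set ζ := Circle.exp t with hζ
  obtain ⟨ψ, hζψ, hpos, hreal⟩ := exists_positive_slice_chart Ω hα ζ
  have hW : IsOpen (range α)ᶜ := (isCompact_range hαc).isClosed.isOpen_compl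
  obtain ⟨r, hr, hball⟩ := Metric.isOpen_iff.1 ψ.open_target _ (ψ.map_source hζψ)
  set z := ψ (α ζ) with hz
  set ε := r / 10 with hε
  have hεpos : 0 < ε := by positivity
  -- The two poles lie on either side of the curve, at height `± ε`.
  have hmem : ∀ s : ℝ, |s| = ε → z + s * Complex.I ∈ ψ.target := by
    intro s hs
    apply hball
    simp [dist_eq_norm, hs]
    linarith
  have hat := hmem ε (abs_of_pos hεpos)
  have hbt := hmem (-ε) (by rw [abs_neg, abs_of_pos hεpos])
  set a := ψ.symm (z + (ε : ℝ) * Complex.I) with ha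
  set b := ψ.symm (z + (-ε : ℝ) * Complex.I) with hb
  have hψa : ψ a = z + (ε : ℝ) * Complex.I := ψ.right_inv hat
  have hψb : ψ b = z + (-ε : ℝ) * Complex.I := ψ.right_inv hbt
  have has : a ∈ ψ.source := ψ.map_target hat
  have hbs : b ∈ ψ.source := ψ.map_target hbt
  have hzim : z.im = 0 := hreal ζ hζψ
  have haW : a ∈ (range α)ᶜ := by
    rintro ⟨η, hη⟩
    have := hreal η (hη ▸ has)
    rw [hη, hψa] at this
    simp [hzim] at this
    linarith
  have hbW : b ∈ (range α)ᶜ := by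
    rintro ⟨η, hη⟩
    have := hreal η (hη ▸ hbs)
    rw [hη, hψb] at this
    simp [hzim] at this
    linarith
  have hab : a ≠ b := by
    intro h
    have := congrArg Complex.im (hψa.symm.trans ((congrArg ψ h).trans hψb))
    simp at this
    linarith
  have hdist : ‖ψ a - ψ b‖ = 2 * ε := by
    rw [hψa, hψb, show z + (ε : ℝ) * Complex.I - (z + (-ε : ℝ) * Complex.I) =
      ((2 * ε : ℝ) : ℂ) * Complex.I by push_cast; ring, norm_mul, Complex.norm_I, mul_one,
      Complex.norm_real, Real.norm_of_nonneg (by positivity)]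
  have hsub : Metric.closedBall (ψ b) (4 * ‖ψ a - ψ b‖) ⊆ ψ.target := by
    refine (Metric.closedBall_subset_ball' ?_).trans hball
    rw [hdist, hψb, dist_eq_norm]
    simp [abs_of_pos hεpos]
    linarith
  obtain ⟨H₀, hH₀, h₀1, h₀⟩ := exists_hasIndex_pairIndex hpos has hbs hab hsub
    (hW.mem_nhds haW) (hW.mem_nhds hbW)
  obtain ⟨H₁, hH₁, K₁, hK₁W, hK₁, h₁1⟩ := exists_hasIndex_pairIndex_of_isPreconnected (Ω := Ω) hW
    hsep.isPreconnected haW hbW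
  set H := H₀ * H₁⁻¹ with hH
  have hHc : Continuous H := continuous_iff_continuousAt.2 fun x ↦ by
    have := (hH₀ x).mul (hH₁ x).inv
    rw [add_neg_cancel] at this
    exact hasIndex_zero_iff.1 this
  have hHK : ∀ y ∉ pairSupport ψ a b ∪ K₁, H y = 1 := by
    intro y hy
    rw [hH, Pi.mul_apply, Pi.inv_apply, h₀1 y fun h ↦ hy (Or.inl h), h₁1 y fun h ↦ hy (Or.inr h)]
    simp
  have hHτ : ∀ η, H (α η) = pairMap ψ a b (α η) := by
    intro η
    rw [hH, Pi.mul_apply, Pi.inv_apply, h₁1 _ fun h ↦ hK₁W h (mem_range_self η), inv_one, mul_one]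
    exact h₀ _ fun h ↦ h.elim (fun h ↦ h (mem_range_self η)) fun h ↦ h (mem_range_self η)
  -- the abscissa along the curve
  set x : Circle → ℝ := fun η ↦ (ψ (α η)).re - z.re with hx
  set q : ℝ → ℂ := fun x ↦ ((x : ℂ) - ε * Complex.I) / (x + ε * Complex.I) with hq
  have hHq : ∀ η, α η ∈ ψ.source → H (α η) = flatDir (q (x η)) := by
    intro η hη
    have h1 : ψ (α η) = z + (x η : ℝ) := by
      apply Complex.ext <;> simp [hx, hreal η hη, hzim]
    rw [hHτ, pairMap_of_mem hη, hψa, hψb, h1, hq]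
    congr 2
    · ring
    · push_cast
      ring
  have hxinj : ∀ η η', α η ∈ ψ.source → α η' ∈ ψ.source → x η = x η' → η = η' := by
    intro η η' h h' he
    refine hα.isEmbedding.injective (ψ.injOn h h' (Complex.ext ?_ ?_))
    · simpa [hx] using he
    · rw [hreal η h, hreal η' h']
  have hx0 : x ζ = 0 := sub_self _
  have hslit : ∀ η, η ≠ ζ → (H (α η) : ℂ) ∈ Complex.slitPlane := by
    intro η hη
    by_cases hs : α η ∈ ψ.source
    · rw [hHq η hs]
      refine flatDir_mem_slitPlane (Or.inr ?_)
      have hxη : x η ≠ 0 := fun h ↦ hη (hxinj η ζ hs hζψ (h.trans hx0.symm))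
      rw [hq, im_quotient]
      have : 0 < x η ^ 2 + ε ^ 2 := by positivity
      exact mul_ne_zero (neg_ne_zero.2 (by positivity)) hxη
    · rw [hHτ, pairMap, if_neg hs]
      simp
  -- near the crossing point, the map is the quotient itself
  have hnear : ∀ η, α η ∈ ψ.source → |x η| < ε → (H (α η) : ℂ) = q (x η) := by
    intro η hs hxη
    have hd : (x η : ℂ) + ε * Complex.I ≠ 0 := by
      intro h
      have := congrArg Complex.im h
      simp at this
      linarith
    have hnorm : ‖q (x η)‖ = 1 := by
      rw [hq, norm_div, div_eq_one_iff_eq (norm_ne_zero_iff.2 hd), ← RCLike.norm_conj]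
      congr 1
      simp
    have hq0 : q (x η) ≠ 0 := by
      rw [← norm_ne_zero_iff, hnorm]
      exact one_ne_zero
    rw [hHq η hs, flatDir_eq_dir, coe_dir hq0, hnorm]
    · simp
    · rw [hq]
      have h1 : ‖(x η : ℂ) + ε * Complex.I‖ ≤ 2 * ε := by
        refine (norm_add_le _ _).trans ?_
        simp [abs_of_pos hεpos]
        linarith
      rw [div_sub_one hd, norm_div, le_div_iff₀ (norm_pos_iff.2 hd),
        show (x η : ℂ) - ε * Complex.I - (x η + ε * Complex.I) = ((-(2 * ε) : ℝ) : ℂ) * Complex.I by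
          push_cast; ring, norm_mul, Complex.norm_I, Complex.norm_real, norm_neg,
        Real.norm_of_nonneg (by positivity)]
      linarith
  have hneg : (H (α ζ) : ℂ) = -1 := by
    rw [hnear ζ hζψ (by rw [hx0, abs_zero]; exact hεpos), hx0, hq]
    have : (ε : ℂ) * Complex.I ≠ 0 := by simp [hεpos.ne']
    simp only [Complex.ofReal_zero, zero_sub, zero_add]
    exact neg_div_self this
  -- the abscissa is strictly monotone in the angle
  have hcont : ∀ η, α η ∈ ψ.source → ContinuousAt x η := fun η h ↦
    (Complex.continuous_re.continuousAt.comp (f := fun η ↦ ψ (α η))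
      ((ψ.continuousAt h).comp hαc.continuousAt)).sub continuousAt_const
  have hevt : ∀ᶠ θ in 𝓝 t, α (Circle.exp θ) ∈ ψ.source ∧ |x (Circle.exp θ)| < ε := by
    have h1 : ∀ᶠ η in 𝓝 ζ, α η ∈ ψ.source ∧ |x η| < ε := by
      refine (hαc.continuousAt.eventually (ψ.open_source.mem_nhds hζψ)).and ?_
      exact (hcont ζ hζψ).abs.eventually_lt continuousAt_const (by rw [hx0, abs_zero]; exact hεpos)
    exact Circle.exp.continuous.continuousAt.eventually h1
  obtain ⟨δ, hδ, hδt⟩ := Metric.eventually_nhds_iff_ball.1 hevt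
  set δ' := min (δ / 2) 1 with hδ'
  have hδ'pos : 0 < δ' := lt_min (by linarith) one_pos
  have hI : ∀ θ ∈ Icc (t - δ') (t + δ'), α (Circle.exp θ) ∈ ψ.source ∧ |x (Circle.exp θ)| < ε := by
    intro θ hθ
    apply hδt
    rw [Metric.mem_ball, Real.dist_eq, abs_lt]
    have := min_le_left (δ / 2) 1
    constructor <;> linarith [hθ.1, hθ.2]
  have hinjI : InjOn (fun θ ↦ x (Circle.exp θ)) (Icc (t - δ') (t + δ')) := by
    intro θ hθ θ' hθ' h
    have h1 := hxinj _ _ (hI θ hθ).1 (hI θ' hθ').1 h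
    refine Circle.exp_injOn_Icc ?_ hθ hθ' h1
    have := min_le_right (δ / 2) 1
    linarith [Real.pi_gt_three]
  have hcontI : ContinuousOn (fun θ ↦ x (Circle.exp θ)) (Icc (t - δ') (t + δ')) := fun θ hθ ↦
    ((hcont _ (hI θ hθ).1).comp Circle.exp.continuous.continuousAt).continuousWithinAt
  have hmemI : ∀ᶠ θ in 𝓝 t, θ ∈ Icc (t - δ') (t + δ') := Icc_mem_nhds (by linarith) (by linarith)
  have htI : t ∈ Icc (t - δ') (t + δ') := hmemI.self_of_nhds
  have him : ∀ θ ∈ Icc (t - δ') (t + δ'), ∃ c : ℝ, 0 < c ∧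
      (H (α (Circle.exp θ)) : ℂ).im = -c * x (Circle.exp θ) := by
    intro θ hθ
    refine ⟨2 * ε / (x (Circle.exp θ) ^ 2 + ε ^ 2), by positivity, ?_⟩
    rw [hnear _ (hI θ hθ).1 (hI θ hθ).2, hq, im_quotient]
  have hcompact : IsCompact (pairSupport ψ a b ∪ K₁) := (isCompact_pairSupport hsub).union hK₁
  rcases hcontI.strictMonoOn_of_injOn_Icc' (by linarith) hinjI with hmono | hanti
  · refine ⟨H, hHc, ⟨_, hcompact, hHK⟩, hHc.comp hαc, hneg, hslit, ?_⟩
    filter_upwards [nhdsWithin_le_nhds hmemI, self_mem_nhdsWithin] with θ hθ hne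
    obtain ⟨c, hc, h⟩ := him θ hθ
    rw [Function.comp_apply, h]
    rcases lt_or_gt_of_ne hne with h1 | h1
    · have h2 : x (Circle.exp θ) < x ζ := hmono hθ htI h1
      rw [hx0] at h2
      nlinarith [mul_pos_of_neg_of_neg (sub_neg.2 h1) h2]
    · have h2 : x ζ < x (Circle.exp θ) := hmono htI hθ h1
      rw [hx0] at h2
      nlinarith [mul_pos (sub_pos.2 h1) h2]
  · refine ⟨H⁻¹, hHc.inv, ⟨_, hcompact, fun y hy ↦ by simp [hHK y hy]⟩, (hHc.comp hαc).inv, ?_, ?_, ?_⟩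
    · simp [← hζ, hneg]
    · intro η hη
      simpa [Complex.mem_slitPlane_iff] using hslit η hη
    filter_upwards [nhdsWithin_le_nhds hmemI, self_mem_nhdsWithin] with θ hθ hne
    obtain ⟨c, hc, h⟩ := him θ hθ
    have h' : (((H⁻¹ ∘ α) (Circle.exp θ) : Circle) : ℂ).im = c * x (Circle.exp θ) := by
      rw [Function.comp_apply, Pi.inv_apply, Circle.coe_inv_eq_conj, Complex.conj_im, h]
      ring
    rw [h']
    rcases lt_or_gt_of_ne hne with h1 | h1
    · have h2 : x ζ < x (Circle.exp θ) := hanti hθ htI h1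
      rw [hx0] at h2
      nlinarith [mul_pos (sub_pos.2 h1) h2]
    · have h2 : x (Circle.exp θ) < x ζ := hanti htI hθ h1
      rw [hx0] at h2
      nlinarith [mul_pos (sub_pos.2 h1) (neg_pos.2 h2)]

end Crossing

section Final

variable {M : Type*} [TopologicalSpace M] [ChartedSpace Plane M] [IsManifold (𝓡 2) ∞ M]

/-- A circle-valued map that is `1` outside a compact set restricts to any prescribed map of
the curve passing once through `-1`. -/
theorem exists_continuous_extension [T2Space M] [SecondCountableTopology M] (Ω : SymplecticForm M)
    {α : Circle → M} (hα : IsSmoothEmbedding (𝓡 1) (𝓡 2) ∞ α) (hsep : IsConnected (range α)ᶜ)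
    {k : Circle → Circle} {t : ℝ} (hk : CrossesNegOneAt k t) :
    ∃ H : M → Circle, Continuous H ∧ (∃ K : Set M, IsCompact K ∧ ∀ y ∉ K, H y = 1) ∧
      ∀ η, H (α η) = k η := by
  have : LocallyCompactSpace M := ChartedSpace.locallyCompactSpace Plane M
  obtain ⟨H, hH, ⟨K, hK, hHK⟩, hm⟩ := exists_continuous_crossing Ω hα hsep t
  obtain ⟨u, hu⟩ := hm.exists_eq_mul_exp hk
  have hαc : Continuous α := hα.isEmbedding.continuous
  have hcl : IsClosedEmbedding α := hαc.isClosedEmbedding hα.isEmbedding.injective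
  obtain ⟨v, hv⟩ := ContinuousMap.exists_extension' hcl u
  obtain ⟨χ, h1, -, hχ, -⟩ := exists_continuous_one_zero_of_isCompact (isCompact_range hαc)
    isClosed_empty (disjoint_empty _)
  refine ⟨fun y ↦ H y * Circle.exp (χ y * v y), by fun_prop, ⟨K ∪ tsupport χ, hK.union hχ, ?_⟩, ?_⟩
  · intro y hy
    change H y * Circle.exp (χ y * v y) = 1
    rw [hHK y fun h ↦ hy (Or.inl h), image_eq_zero_of_notMem_tsupport fun h ↦ hy (Or.inr h)]
    simp
  · intro η
    have h2 : v (α η) = u η := congrFun hv η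
    change H (α η) * Circle.exp (χ (α η) * v (α η)) = k η
    rw [h1 (mem_range_self η), h2, hu η]
    simp

/-! ### Functions of the direction have vanishing Poisson bracket -/

/-- Two linear forms on `ℂ` with a common nonzero kernel vector are proportional. -/
theorem mul_apply_comm_of_apply_eq_zero {L N : ℂ →L[ℝ] ℝ} {z : ℂ} (hz : z ≠ 0) (hL : L z = 0)
    (hN : N z = 0) (u v : ℂ) : L u * N v = L v * N u := by
  have key : ∀ (A : ℂ →L[ℝ] ℝ), A z = 0 → ∀ u, A u = (u / z).im * A (Complex.I * z) := by
    intro A hA u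
    have h : u = (u / z).re • z + (u / z).im • (Complex.I * z) := by
      have h1 : u = (u / z) * z := by field_simp
      conv_lhs => rw [h1, ← Complex.re_add_im (u / z)]
      simp only [Complex.real_smul]
      ring
    conv_lhs => rw [h]
    rw [map_add, map_smul, map_smul, hA, smul_zero, zero_add, smul_eq_mul]
  rw [key L hL u, key L hL v, key N hN u, key N hN v]
  ring

/-- Functions constant along rays have a radial kernel vector. -/
theorem fderiv_apply_self_of_homogeneous {φ : ℂ → ℝ} {z : ℂ} (hφ : DifferentiableAt ℝ φ z)
    (h : ∀ c : ℝ, 0 < c → φ (c • z) = φ z) : fderiv ℝ φ z z = 0 := by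
  have h1 : HasDerivAt (fun c : ℝ ↦ c • z) z 1 := by
    simpa using (hasDerivAt_id (1 : ℝ)).smul_const z
  have h2 : HasFDerivAt φ (fderiv ℝ φ z) ((1 : ℝ) • z) := by simpa using hφ.hasFDerivAt
  have h3 := h2.comp_hasDerivAt (1 : ℝ) h1
  have h4 : HasDerivAt (φ ∘ fun c : ℝ ↦ c • z) 0 1 := by
    refine (hasDerivAt_const (1 : ℝ) (φ z)).congr_of_eventuallyEq ?_
    filter_upwards [lt_mem_nhds (one_pos : (0 : ℝ) < 1)] with c hc using h c hc
  exact h3.unique h4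

/-- The Poisson bracket `{F, G}` vanishes if `F` and `G` depend only on the direction of a nowhere zero
complex-valued function. -/
theorem poissonBracket_comp_eq_zero (Ω : SymplecticForm M) {g : M → ℂ} {φ χ : ℂ → ℝ} {x : M}
    (hg : MDifferentiableAt (𝓡 2) 𝓘(ℝ, ℂ) g x) (hgx : g x ≠ 0) (hφ : DifferentiableAt ℝ φ (g x))
    (hχ : DifferentiableAt ℝ χ (g x)) (hφr : ∀ c : ℝ, 0 < c → φ (c • g x) = φ (g x))
    (hχr : ∀ c : ℝ, 0 < c → χ (c • g x) = χ (g x)) :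
    poissonBracket Ω (fun y ↦ φ (g y)) (fun y ↦ χ (g y)) x = 0 := by
  rw [poissonBracket, wedgeDifferentials]
  simp only [mvfderiv_comp_fderiv hg hφ, mvfderiv_comp_fderiv hg hχ]
  rw [mul_apply_comm_of_apply_eq_zero hgx (fderiv_apply_self_of_homogeneous hφ hφr)
    (fderiv_apply_self_of_homogeneous hχ hχr), sub_self, neg_zero, zero_div]

/-- A smooth step in the direction `l` of the plane: as a function of the
direction `z / |z|`, it is `0` where `l ≤ -1/2` and `1` where `l ≥ 1/2`. -/
noncomputable def dirStep (l : ℂ →L[ℝ] ℝ) (z : ℂ) : ℝ :=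
  Real.smoothTransition (l z / ‖z‖ + 1 / 2)

theorem contDiffAt_dirStep (l : ℂ →L[ℝ] ℝ) {z : ℂ} (hz : z ≠ 0) :
    ContDiffAt ℝ ∞ (dirStep l) z := by
  refine Real.smoothTransition.contDiffAt.comp z ?_
  exact (l.contDiff.contDiffAt.div (contDiffAt_norm ℝ hz) (norm_ne_zero_iff.2 hz)).add
    contDiffAt_const

theorem dirStep_smul (l : ℂ →L[ℝ] ℝ) (z : ℂ) {c : ℝ} (hc : 0 < c) :
    dirStep l (c • z) = dirStep l z := by
  rw [dirStep, dirStep, map_smul, norm_smul, Real.norm_of_nonneg hc.le, smul_eq_mul,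
    mul_div_mul_left _ _ hc.ne']

/-- The direction of an approximation of a unit vector is an approximation of it. -/
theorem norm_div_norm_sub_le {z w : ℂ} (hw : ‖w‖ = 1) (h : ‖z - w‖ ≤ 1 / 8) :
    ‖z / ‖z‖ - w‖ ≤ 1 / 4 := by
  have h1 : |‖z‖ - 1| ≤ 1 / 8 := by
    simpa only [hw] using (abs_norm_sub_norm_le z w).trans h
  have h2 : 0 < ‖z‖ := by
    have := (abs_le.1 h1).1
    linarith
  have h3 : ‖z / ‖z‖ - z‖ = |‖z‖ - 1| := by
    have h4 : (‖z‖ : ℂ) ≠ 0 := by simpa using h2.ne'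
    have : z / ‖z‖ - z = (z / ‖z‖) * ((1 - ‖z‖ : ℝ) : ℂ) := by
      push_cast
      field_simp
    rw [this, norm_mul, norm_div, Complex.norm_real, Complex.norm_real, norm_norm,
      div_self h2.ne', one_mul, Real.norm_eq_abs, abs_sub_comm]
  calc ‖z / ‖z‖ - w‖ ≤ ‖z / ‖z‖ - z‖ + ‖z - w‖ := norm_sub_le_norm_sub_add_norm_sub _ _ _
    _ ≤ 1 / 4 := by rw [h3]; linarith

theorem exists_smooth_approx [T2Space M] [SecondCountableTopology M] {H : M → Circle}
    (hH : Continuous H) :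
    ∃ g : M → ℂ, ContMDiff (𝓡 2) 𝓘(ℝ, ℂ) ∞ g ∧ ∀ x, ‖g x - H x‖ ≤ 1 / 8 := by
  have : LocallyCompactSpace M := ChartedSpace.locallyCompactSpace Plane M
  have hc : Continuous fun x ↦ (H x : ℂ) := continuous_subtype_val.comp hH
  obtain ⟨g, hg, -⟩ := hc.exists_contMDiff_approx (𝓡 2) ⊤ (ε := fun _ ↦ 1 / 8) continuous_const
    (fun _ ↦ by norm_num)
  exact ⟨g, g.contMDiff, fun x ↦ by simpa [dist_eq_norm] using (hg x).le⟩

theorem abs_apply_dir_sub_le {l : ℂ →L[ℝ] ℝ} (hl : ∀ u, |l u| ≤ 2 * ‖u‖) {z w : ℂ}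
    (hw : ‖w‖ = 1) (h : ‖z - w‖ ≤ 1 / 8) : |l z / ‖z‖ - l w| ≤ 1 / 2 := by
  have h1 : l z / ‖z‖ - l w = l (z / ‖z‖ - w) := by
    have : z / ‖z‖ = (‖z‖⁻¹ : ℝ) • z := by
      rw [Complex.real_smul, Complex.ofReal_inv, div_eq_inv_mul]
    rw [map_sub, this, map_smul, smul_eq_mul, div_eq_inv_mul]
  rw [h1]
  linarith [hl (z / ‖z‖ - w), norm_div_norm_sub_le hw h]

theorem dirStep_eq_zero {l : ℂ →L[ℝ] ℝ} (hl : ∀ u, |l u| ≤ 2 * ‖u‖) {z w : ℂ}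
    (hw : ‖w‖ = 1) (h : ‖z - w‖ ≤ 1 / 8) (hlw : l w ≤ -1) : dirStep l z = 0 := by
  refine Real.smoothTransition.zero_of_nonpos ?_
  linarith [(abs_le.1 (abs_apply_dir_sub_le hl hw h)).2]

theorem dirStep_eq_one {l : ℂ →L[ℝ] ℝ} (hl : ∀ u, |l u| ≤ 2 * ‖u‖) {z w : ℂ}
    (hw : ‖w‖ = 1) (h : ‖z - w‖ ≤ 1 / 8) (hlw : 1 ≤ l w) : dirStep l z = 1 := by
  refine Real.smoothTransition.one_of_one_le ?_
  linarith [(abs_le.1 (abs_apply_dir_sub_le hl hw h)).1]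

/-- On the unit circle, the sum of the absolute values of the coordinates is at least `1`. -/
theorem one_le_abs_re_add_abs_im (w : Circle) : 1 ≤ |(w : ℂ).re| + |(w : ℂ).im| := by
  have := Complex.norm_le_abs_re_add_abs_im (w : ℂ)
  rwa [Circle.norm_coe] at this

theorem lqNorm_zero [MeasurableSpace M] (Ω : SymplecticForm M) {q : ℝ≥0∞} (hq : 1 ≤ q)
    {f : M → ℝ} (hf : ∀ x, f x = 0) : lqNorm Ω q f = 0 := by
  unfold lqNorm
  split_ifs with h
  · simp [hf]
  · have : 0 < q.toReal := ENNReal.toReal_pos (zero_lt_one.trans_le hq).ne' h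
    simp [hf, this]

/-- An admissible pair of Poisson commuting functions makes the invariant vanish. -/
theorem pb4_eq_zero_of_mem [MeasurableSpace M] (Ω : SymplecticForm M) {q : ℝ≥0∞} (hq : 1 ≤ q)
    {X₀ X₁ Y₀ Y₁ : Set M} {F G : M → ℝ} (h : (F, G) ∈ admissiblePairs X₀ X₁ Y₀ Y₁)
    (hFG : ∀ x, poissonBracket Ω F G x = 0) : pb4 Ω q X₀ X₁ Y₀ Y₁ = 0 := by
  refine le_antisymm ?_ bot_le
  rw [← lqNorm_zero Ω hq hFG]
  exact iInf₂_le (f := fun (P : (M → ℝ) × (M → ℝ)) (_ : P ∈ admissiblePairs X₀ X₁ Y₀ Y₁) ↦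
    lqNorm Ω q (poissonBracket Ω P.1 P.2)) (F, G) h

end Final

/-- On a connected symplectic surface `(M, Ω)` without boundary, `pb₄^q(τ) = 0` for every smooth
non-separating simple closed curve `τ = α(S¹)`, every division of `τ` into four segments and every
`1 ≤ q ≤ ∞`. -/
theorem theorem1p3 {M : Type*} [TopologicalSpace M] [T2Space M] [SecondCountableTopology M]
    [ConnectedSpace M] [ChartedSpace Plane M] [IsManifold (𝓡 2) ∞ M]
    [MeasurableSpace M] [BorelSpace M] (Ω : SymplecticForm M)
    (α : Circle → M) (hα : IsSmoothEmbedding (𝓡 1) (𝓡 2) ∞ α)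
    (hsep : IsConnected (range α)ᶜ)
    (t : Fin 4 → ℝ) (ht : StrictMono t) (ht' : t 3 < t 0 + 2 * Real.pi)
    (q : ℝ≥0∞) (hq : 1 ≤ q) :
    curvePb4 Ω q α t = 0 := by
  obtain ⟨k, hk, hk1, hk2, hk3, hk4⟩ := exists_map_to_quadrants ht ht'
  obtain ⟨H, hH, ⟨K, hK, hHK⟩, hHk⟩ := exists_continuous_extension Ω hα hsep hk
  obtain ⟨g, hgs, hg⟩ := exists_smooth_approx hH
  have hg0 : ∀ x, g x ≠ 0 := by
    intro x h
    have := hg x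
    rw [h, zero_sub, norm_neg, Circle.norm_coe] at this
    norm_num at this
  set l₁ : ℂ →L[ℝ] ℝ := Complex.imCLM - Complex.reCLM with hl₁
  set l₂ : ℂ →L[ℝ] ℝ := -Complex.reCLM - Complex.imCLM with hl₂
  have hb₁ : ∀ u, |l₁ u| ≤ 2 * ‖u‖ := fun u ↦ (abs_sub u.im u.re).trans (by
    linarith [Complex.abs_re_le_norm u, Complex.abs_im_le_norm u])
  have hb₂ : ∀ u, |l₂ u| ≤ 2 * ‖u‖ := fun u ↦ (abs_sub (-u.re) u.im).trans (by
    rw [abs_neg]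
    linarith [Complex.abs_re_le_norm u, Complex.abs_im_le_norm u])
  have hF0 : ∀ x, 0 ≤ (H x : ℂ).re → (H x : ℂ).im ≤ 0 → dirStep l₁ (g x) = 0 := by
    intro x h1 h2
    refine dirStep_eq_zero hb₁ (Circle.norm_coe (H x)) (hg x) ?_
    have h3 := one_le_abs_re_add_abs_im (H x)
    rw [abs_of_nonneg h1, abs_of_nonpos h2] at h3
    change (H x : ℂ).im - (H x : ℂ).re ≤ -1
    linarith
  have hF1 : ∀ x, (H x : ℂ).re ≤ 0 → 0 ≤ (H x : ℂ).im → dirStep l₁ (g x) = 1 := by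
    intro x h1 h2
    refine dirStep_eq_one hb₁ (Circle.norm_coe (H x)) (hg x) ?_
    have h3 := one_le_abs_re_add_abs_im (H x)
    rw [abs_of_nonpos h1, abs_of_nonneg h2] at h3
    change 1 ≤ (H x : ℂ).im - (H x : ℂ).re
    linarith
  have hG0 : ∀ x, 0 ≤ (H x : ℂ).re → 0 ≤ (H x : ℂ).im → dirStep l₂ (g x) = 0 := by
    intro x h1 h2
    refine dirStep_eq_zero hb₂ (Circle.norm_coe (H x)) (hg x) ?_
    have h3 := one_le_abs_re_add_abs_im (H x)
    rw [abs_of_nonneg h1, abs_of_nonneg h2] at h3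
    change -(H x : ℂ).re - (H x : ℂ).im ≤ -1
    linarith
  have hG1 : ∀ x, (H x : ℂ).re ≤ 0 → (H x : ℂ).im ≤ 0 → dirStep l₂ (g x) = 1 := by
    intro x h1 h2
    refine dirStep_eq_one hb₂ (Circle.norm_coe (H x)) (hg x) ?_
    have h3 := one_le_abs_re_add_abs_im (H x)
    rw [abs_of_nonpos h1, abs_of_nonpos h2] at h3
    change 1 ≤ -(H x : ℂ).re - (H x : ℂ).im
    linarith
  have hsmooth : ∀ l : ℂ →L[ℝ] ℝ, ContMDiff (𝓡 2) 𝓘(ℝ, ℝ) ∞ fun x ↦ dirStep l (g x) :=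
    fun l x ↦ (contDiffAt_dirStep l (hg0 x)).contMDiffAt.comp x (hgs x)
  have hadm : ((fun x ↦ dirStep l₁ (g x)), (fun x ↦ dirStep l₂ (g x))) ∈
      admissiblePairs (α '' circleSegment (t 0) (t 1)) (α '' circleSegment (t 2) (t 3))
        (α '' circleSegment (t 1) (t 2)) (α '' circleSegment (t 3) (t 0 + 2 * Real.pi)) := by
    refine ⟨⟨hsmooth _, HasCompactSupport.intro hK fun x hx ↦ hF0 x ?_ ?_⟩,
      ⟨hsmooth _, HasCompactSupport.intro hK fun x hx ↦ hG0 x ?_ ?_⟩, ?_, ?_, ?_, ?_⟩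
    · simp [hHK x hx]
    · simp [hHK x hx]
    · simp [hHK x hx]
    · simp [hHK x hx]
    · rintro _ ⟨η, hη, rfl⟩
      exact (hF0 _ (by rw [hHk]; exact (hk1 η hη).1) (by rw [hHk]; exact (hk1 η hη).2)).le
    · rintro _ ⟨η, hη, rfl⟩
      exact (hF1 _ (by rw [hHk]; exact (hk3 η hη).1) (by rw [hHk]; exact (hk3 η hη).2)).ge
    · rintro _ ⟨η, hη, rfl⟩
      exact (hG0 _ (by rw [hHk]; exact (hk2 η hη).1) (by rw [hHk]; exact (hk2 η hη).2)).le
    · rintro _ ⟨η, hη, rfl⟩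
      exact (hG1 _ (by rw [hHk]; exact (hk4 η hη).1) (by rw [hHk]; exact (hk4 η hη).2)).ge
  have hbr : ∀ x, poissonBracket Ω (fun x ↦ dirStep l₁ (g x)) (fun x ↦ dirStep l₂ (g x)) x = 0 :=
    fun x ↦ poissonBracket_comp_eq_zero Ω ((hgs x).mdifferentiableAt (by simp)) (hg0 x)
      ((contDiffAt_dirStep _ (hg0 x)).differentiableAt (by simp))
      ((contDiffAt_dirStep _ (hg0 x)).differentiableAt (by simp))
      (fun c hc ↦ dirStep_smul _ _ hc) (fun c hc ↦ dirStep_smul _ _ hc)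
  exact pb4_eq_zero_of_mem Ω hq hadm hbr
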